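/- Let $X$ be an irreducible, reduced, regular projective curve over $\mathbb F_q$, geometrically irreducible (field of constants $\mathbb F_q$), of genus $g=\dim H^1(X,\mathcal O_X)$. Let $\omega_1,\dots,\omega_{2g}$ be its Frobenius eigenvalues, so that $\#X(\mathbb F_{q^n})=q^n+1-\sum_i\omega_i^n$ for $n\ge1$; let $$\zeta_X(s)=\frac{\prod_{i=1}^{2g}(1-\omega_iq^{-s})}{(1-q^{-s})(1-q\,q^{-s})},\qquad \widehat\zeta_X(s)=q^{(g-1)s}\zeta_X(s)$$ be the Artin zeta function and the complete Artin zeta function. Let $\Phi$ be a reduced crystallographic root system (that of a split connected reductive group $G$ over the function field of $X$) with base $\Delta=\{\alpha_1,\dots,\alpha_n\}$, positive roots $\Phi^+$, negative roots $\Phi^-$, Weyl group $W$, Weyl vector $\rho=\frac12\sum_{\alpha\in\Phi^+}\alpha$, and fundamental weights $\lambda_j$ given by $\langle\lambda_j,\alpha_i^\vee\rangle=\delta_{ij}$. Put $\mathrm{ht}\,\alpha^\vee=\langle\rho,\alpha^\vee\rangle$ and $\Phi_w=\Phi^+\cap w^{-1}\Phi^-$. Fix $p\in\{1,\dots,n\}$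 (that is, a maximal standard parabolic subgroup $P$ of $G$), and let $\Delta_p=\Delta\setminus\{\alpha_p\}$, $\mathfrak W_p=\{w\in W: w\Delta_p\subset\Delta\cup\Phi^-\}$, $$N_{p,w}(k,h)=\#\{\alpha\in w^{-1}\Phi^-:\langle\lambda_p,\alpha^\vee\rangle=k,\ \mathrm{ht}\,\alpha^\vee=h\},\qquad M_p(k,h)=\max_{w\in\mathfrak W_p}\big(N_{p,w}(k,h-1)-N_{p,w}(k,h)\big).$$ With $\lambda=\rho+\sum_j s_j\lambda_j$, $s_j\in\mathbb C$, define the periods $$\omega_w^G(\lambda)=\prod_{\alpha\in\Delta}\frac1{1-q^{-\langle w\lambda-\rho,\alpha^\vee\rangle}}\prod_{\alpha\in\Phi_w}\frac{\widehat\zeta_X(\langle\lambda,\alpha^\vee\rangle)}{\widehat\zeta_X(\langle\lambda,\alpha^\vee\rangle+1)},\qquad \omega_X^G=\sum_{w\in W}\omega_w^G,$$ and let $\omega_X^{(G,P)}(s)$, $s=s_p$, be the iterated residue of $\omega_X^G(\lambda)$ at $s_j=0$ for all $j\ne p$, taken in any fixed order. (1) As meromorphic functions of $s$ (that is, outside a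 closed discrete set), the iterated residue of $\omega_w^G$ is $0$ for $w\notin\mathfrak W_p$, and for $w\in\mathfrak W_p$ it is $$T_w(s)=\Big(\frac1{\log q}\Big)^{\#(w^{-1}\Delta\cap\Delta_p)}\big(\mathrm{Res}_{s=1}\widehat\zeta_X(s)\big)^{\#(\Phi_w\cap\Delta_p)}\prod_{\alpha\in w^{-1}\Delta\setminus\Delta_p}\frac1{1-q^{-\langle\lambda_p,\alpha^\vee\rangle s-\mathrm{ht}\,\alpha^\vee+1}}\cdot\frac{\prod_{\alpha\in\Phi_w\setminus\Delta_p}\widehat\zeta_X(\langle\lambda_p,\alpha^\vee\rangle s+\mathrm{ht}\,\alpha^\vee)}{\prod_{\alpha\in\Phi_w}\widehat\zeta_X(\langle\lambda_p,\alpha^\vee\rangle s+\mathrm{ht}\,\alpha^\vee+1)};$$ hence $\omega_X^{(G,P)}(s)=\sum_{w\in\mathfrak W_p}T_w(s)$. (2) Regard the $\widehat\zeta_X(as+b)$ in $T_w$ as formal symbols indexed by $(a,b)$. Among the finite families (multisets) of zeta factors whose product with every term $T_w$, $w\in\mathfrak W_p$, has after cancellation no zeta factor left in the denominator, there is exactly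 one, $\big(\widehat\zeta_X(a_is+b_i)\big)_{1\le i\le I(G,P)}$, with the minimal number of members. It consists of the $\widehat\zeta_X(ks+h)$ with integers $k\ge0$, $h\ge2$, each with multiplicity $M_p(k,h)$. (3) Consequently the zeta function $\widehat\zeta_X^{(G,P)}(s):=\prod_{i=1}^{I(G,P)}\widehat\zeta_X(a_is+b_i)\cdot\omega_X^{(G,P)}(s)$ of $X$ associated to $(G,P)$ is $$\widehat\zeta_X^{(G,P)}(s)=\omega_X^{(G,P)}(s)\cdot\prod_{k=0}^\infty\prod_{h=2}^\infty\widehat\zeta_X(ks+h)^{M_p(k,h)}.$$ -/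

import Mathlib

open AlgebraicGeometry CategoryTheory

open scoped Polynomial Topology

/-! ### Curves over finite fields and their Artin zeta functions -/

universe u

section Curve

attribute [local instance] MvPolynomial.gradedAlgebra

/-- The projective space of dimension `n` over `k`, as a morphism `ℙⁿ ⟶ Spec k`. -/
noncomputable def projectiveSpaceHom (k : Type u) [Field k] (n : ℕ) :
    Proj (MvPolynomial.homogeneousSubmodule (Fin (n + 1)) k) ⟶ Spec (.of k) :=
  Proj.toSpecZero (MvPolynomial.homogeneousSubmodule (Fin (n + 1)) k) ≫
    Spec.map (CommRingCat.ofHom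
      (algebraMap k (MvPolynomial.homogeneousSubmodule (Fin (n + 1)) k 0)))

/-- `f : X ⟶ Spec k` makes `X` an irreducible, reduced, regular projective curve over `k`
(with field of constants `k`, that is, geometrically irreducible). -/
structure IsRegularProjectiveCurve {k : Type u} [Field k] {X : Scheme.{u}}
    (f : X ⟶ Spec (.of k)) : Prop where
  isIntegral : IsIntegral X
  regular : ∀ x : X, IsRegularLocalRing (X.presheaf.stalk x)
  projective : ∃ (n : ℕ)
    (i : X ⟶ Proj (MvPolynomial.homogeneousSubmodule (Fin (n + 1)) k)),
    IsClosedImmersion i ∧ i ≫ projectiveSpaceHom k n = f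
  dim_eq_one : topologicalKrullDim X = 1
  geometricallyIrreducible : GeometricallyIrreducible f

/-- The structure sheaf as a sheaf of abelian groups. -/
noncomputable def structureSheafAb (X : Scheme.{u}) :
    Sheaf (Opens.grothendieckTopology X) AddCommGrpCat.{u} :=
  (sheafCompose _ (forget₂ CommRingCat RingCat.{u} ⋙ forget₂ RingCat AddCommGrpCat.{u})).obj X.sheaf

/-- The genus `dim_k H¹(X, 𝒪_X)` of a curve over a finite field `k`; since `k` is finite, the
dimension is the logarithm to base `#k` of the number of elements. -/
noncomputable def curveGenus {k : Type u} [Field k] {X : Scheme.{u}}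
    (_f : X ⟶ Spec (.of k)) : ℕ :=
  Nat.log (Nat.card k) (Nat.card (Sheaf.H.{u} (structureSheafAb X) 1))

/-- The number of points of `X` over the extension of degree `n` of the finite field `k`; this
extension is the splitting field of `T ^ (#k) ^ n - T`. -/
noncomputable def pointCount {k : Type u} [Field k] {X : Scheme.{u}}
    (f : X ⟶ Spec (.of k)) (n : ℕ) : ℕ :=
  Nat.card {x : Spec (.of (Polynomial.X ^ Nat.card k ^ n - Polynomial.X : k[X]).SplittingField) ⟶ X //
    x ≫ f = Spec.map (CommRingCat.ofHom (algebraMap k _))}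

/-- The Frobenius eigenvalues `ω_1, …, ω_{2g}` of a curve over a finite field with `q` elements:
the complex numbers, unique up to order, with `#X(𝔽_{q^n}) = q^n + 1 - ∑ ω_i^n` for all `n ≥ 1`. -/
noncomputable def frobeniusEigenvalues {k : Type u} [Field k] {X : Scheme.{u}}
    (f : X ⟶ Spec (.of k)) : Fin (2 * curveGenus f) → ℂ :=
  open Classical in
  if h : ∃ ω : Fin (2 * curveGenus f) → ℂ, ∀ n : ℕ, 1 ≤ n →
      (pointCount f n : ℂ) = (Nat.card k : ℂ) ^ n + 1 - ∑ i, ω i ^ n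
  then h.choose else 0

/-- The Artin zeta function
`ζ_X(s) = ∏ (1 - ω_i q^{-s}) / ((1 - q^{-s}) (1 - q q^{-s}))`, on the whole complex plane. -/
noncomputable def artinZeta {k : Type u} [Field k] {X : Scheme.{u}}
    (f : X ⟶ Spec (.of k)) (s : ℂ) : ℂ :=
  (∏ i, (1 - frobeniusEigenvalues f i * (Nat.card k : ℂ) ^ (-s))) /
    ((1 - (Nat.card k : ℂ) ^ (-s)) * (1 - (Nat.card k : ℂ) * (Nat.card k : ℂ) ^ (-s)))

/-- The complete Artin zeta function: a line bundle of degree `d` is weighted by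
`(q^{-s})^{χ} = (q^{-s})^{d - (g - 1)}`, so `ζ̂_X(s) = q^{(g - 1) s} ζ_X(s)`. -/
noncomputable def completeZeta {k : Type u} [Field k] {X : Scheme.{u}}
    (f : X ⟶ Spec (.of k)) (s : ℂ) : ℂ :=
  (Nat.card k : ℂ) ^ (((curveGenus f : ℂ) - 1) * s) * artinZeta f s

end Curve

/-! ### Residues -/

section Residue

/-- The residue at `a` of a function that is holomorphic in a punctured neighbourhood of `a`:
the value of `(2πi)⁻¹ ∮_{|z - a| = r} f(z) dz` for all small `r > 0`. -/
noncomputable def residueAt (f : ℂ → ℂ) (a : ℂ) : ℂ :=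
  Filter.limUnder (𝓝[>] (0 : ℝ)) fun r => (2 * Real.pi * Complex.I)⁻¹ * ∮ z in C(a, r), f z

/-- Iterated residue of a function of several variables along the hyperplanes `s_j = 0`, for `j` in
the list `l`, the head of the list being taken first. The result does not depend on the
coordinates `s_j` with `j ∈ l`. -/
noncomputable def iteratedResidue {J : Type*} [DecidableEq J] :
    List J → ((J → ℂ) → ℂ) → (J → ℂ) → ℂ
  | [], F => F
  | j :: l, F => iteratedResidue l fun s => residueAt (fun z => F (Function.update s j z)) 0

end Residue

/-! ### Root systems

The root system of a split connected reductive group is a reduced crystallographic root system `P`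
in the complexification `M` of `V`, with dual space `N`; `⟨x, α^∨⟩` is `P.toLinearMap x (P.coroot i)`
if `α = P.root i`. A base `b` has the simple roots `P.root j` for `j ∈ b.support`, and a maximal
standard parabolic subgroup corresponds to `p : b.support`. -/

namespace RootPairing.Base

open scoped Classical

variable {ι M N : Type*} [Fintype ι] [AddCommGroup M] [Module ℂ M] [AddCommGroup N] [Module ℂ N]
  {P : RootPairing ι ℂ M N} (b : P.Base)

/-- The Weyl vector, half the sum of the positive roots. -/
noncomputable def weylVector : M :=
  (2 : ℂ)⁻¹ • ∑ i with b.IsPos i, P.root i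

/-- The fundamental weight `λ_j`, defined by `⟨λ_j, α_i^∨⟩ = δ_{ij}` for all simple `α_i`. -/
noncomputable def fundamentalWeight [P.IsRootSystem] (j : b.support) : M :=
  P.toLinearMap.toPerfPair.symm (b.toCoweightBasis.coord j)

/-- `Φ_w = Φ⁺ ∩ w⁻¹Φ⁻`, as a set of indices. -/
noncomputable def inversionSet (w : P.weylGroup) : Finset ι :=
  {i | b.IsPos i ∧ ¬ b.IsPos (P.weylGroupToPerm w i)}

/-- `Δ_p = Δ ∖ {α_p}`, as a set of indices. -/
noncomputable def leviBase (p : b.support) : Finset ι :=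
  b.support.erase p

/-- `𝔚_p`, the set of `w` with `w Δ_p ⊆ Δ ∪ Φ⁻`. -/
def specialWeyl (p : b.support) : Set P.weylGroup :=
  {w | ∀ j ∈ b.leviBase p, P.weylGroupToPerm w j ∈ b.support ∨ ¬ b.IsPos (P.weylGroupToPerm w j)}

/-- The height `ht α^∨ = ⟨ρ, α^∨⟩`. -/
noncomputable def corootHeight (i : ι) : ℂ :=
  P.toLinearMap b.weylVector (P.coroot i)

/-- `⟨λ_p, α^∨⟩`. -/
noncomputable def corootCoeff [P.IsRootSystem] (p : b.support) (i : ι) : ℂ :=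
  P.toLinearMap (b.fundamentalWeight p) (P.coroot i)

/-- `N_{p,w}(k,h) = #{α ∈ w⁻¹Φ⁻ : ⟨λ_p, α^∨⟩ = k, ht α^∨ = h}`. -/
noncomputable def countN [P.IsRootSystem] (p : b.support) (w : P.weylGroup) (k h : ℤ) : ℕ :=
  Finset.card {i : ι | ¬ b.IsPos (P.weylGroupToPerm w i) ∧
    b.corootCoeff p i = k ∧ b.corootHeight i = h}

/-- `M_p(k,h) = max_{w ∈ 𝔚_p} (N_{p,w}(k,h-1) - N_{p,w}(k,h))`. -/
noncomputable def countM [P.IsRootSystem] (p : b.support) (k h : ℤ) : ℤ :=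
  ⨆ w : b.specialWeyl p, ((b.countN p w k (h - 1) : ℤ) - b.countN p w k h)

/-! ### Periods -/

/-- The summand `ω_w^G(λ)` of the period; `q` is the number of elements of the base field and
`Z` is the complete Artin zeta function of the curve. -/
noncomputable def periodTerm (q : ℕ) (Z : ℂ → ℂ) (w : P.weylGroup) (lam : M) : ℂ :=
  (∏ i ∈ b.support,
      1 / (1 - (q : ℂ) ^ (-(P.toLinearMap (w • lam - b.weylVector) (P.coroot i))))) *
    ∏ i ∈ b.inversionSet w,
      Z (P.toLinearMap lam (P.coroot i)) / Z (P.toLinearMap lam (P.coroot i) + 1)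

/-- The period `ω_X^G(λ) = ∑_{w ∈ W} ω_w^G(λ)`; the Weyl group is finite. -/
noncomputable def period (q : ℕ) (Z : ℂ → ℂ) (lam : M) : ℂ :=
  ∑ᶠ w : P.weylGroup, b.periodTerm q Z w lam

/-- The coordinates `λ = ρ + ∑ s_j λ_j`. -/
noncomputable def weightOfCoord [P.IsRootSystem] (s : b.support → ℂ) : M :=
  b.weylVector + ∑ j, s j • b.fundamentalWeight j

/-- For `F` a function of `λ`, the iterated residue along `s_j = 0` for all `j` in `l`, as a function
of `s = s_p`; here `l` enumerates the simple roots other than `α_p`. -/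
noncomputable def parabolicResidue [P.IsRootSystem] (p : b.support) (l : List b.support)
    (F : M → ℂ) (s : ℂ) : ℂ :=
  iteratedResidue l (fun t => F (b.weightOfCoord t)) (Pi.single p s)

/-- The period `ω_X^{(G,P)}(s)` of `(G,P)`. -/
noncomputable def parabolicPeriod [P.IsRootSystem] (q : ℕ) (Z : ℂ → ℂ) (p : b.support)
    (l : List b.support) (s : ℂ) : ℂ :=
  b.parabolicResidue p l (b.period q Z) s

/-! ### Zeta factors and the group zeta function

A zeta factor `ζ̂_X(a s + c)` is recorded by the pair `(a, c)`, a product of zeta factors by a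
multiset of pairs. -/

/-- The zeta factors in the numerator of the term of `w ∈ 𝔚_p` in `ω_X^{(G,P)}(s)`:
`ζ̂_X(⟨λ_p, α^∨⟩ s + ht α^∨)` for `α ∈ Φ_w ∖ Δ_p`. (The roots in `Φ_w ∩ Δ_p` contribute only the
constant `Res_{s=1} ζ̂_X(s)` there.) -/
noncomputable def zetaNumerator [P.IsRootSystem] (p : b.support) (w : P.weylGroup) :
    Multiset (ℂ × ℂ) :=
  (b.inversionSet w \ b.leviBase p).val.map fun i => (b.corootCoeff p i, b.corootHeight i)

/-- The zeta factors in the denominator of the term of `w ∈ 𝔚_p` in `ω_X^{(G,P)}(s)`: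
`ζ̂_X(⟨λ_p, α^∨⟩ s + ht α^∨ + 1)` for `α ∈ Φ_w`. -/
noncomputable def zetaDenominator [P.IsRootSystem] (p : b.support) (w : P.weylGroup) :
    Multiset (ℂ × ℂ) :=
  (b.inversionSet w).val.map fun i => (b.corootCoeff p i, b.corootHeight i + 1)

/-- Multiplication by the zeta factors in `m` leaves, after cancellation, no zeta factor in the
denominator of any term of `ω_X^{(G,P)}(s)`. -/
def ClearsDenominators [P.IsRootSystem] (p : b.support) (m : Multiset (ℂ × ℂ)) : Prop :=
  ∀ w ∈ b.specialWeyl p, b.zetaDenominator p w ≤ m + b.zetaNumerator p w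

/-- `m` is a family of zeta factors that clears all denominators, with the minimal number of
members. -/
def IsMinimalNormalization [P.IsRootSystem] (p : b.support) (m : Multiset (ℂ × ℂ)) : Prop :=
  b.ClearsDenominators p m ∧ ∀ m', b.ClearsDenominators p m' → m.card ≤ m'.card

/-- The minimal normalizing zeta factors `(a_i, b_i)`, `1 ≤ i ≤ I(G,P)`. -/
noncomputable def minimalFactors [P.IsRootSystem] (p : b.support) : Multiset (ℂ × ℂ) :=
  Classical.epsilon (b.IsMinimalNormalization p)

/-- The product of the zeta factors in `m`, at `s`. -/
noncomputable def zetaProduct (Z : ℂ → ℂ) (m : Multiset (ℂ × ℂ)) (s : ℂ) : ℂ :=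
  (m.map fun x => Z (x.1 * s + x.2)).prod

/-- The zeta function `ζ̂_X^{(G,P)}(s) = ∏_i ζ̂_X(a_i s + b_i) · ω_X^{(G,P)}(s)`. -/
noncomputable def groupZeta [P.IsRootSystem] (q : ℕ) (Z : ℂ → ℂ) (p : b.support)
    (l : List b.support) (s : ℂ) : ℂ :=
  zetaProduct Z (b.minimalFactors p) s * b.parabolicPeriod q Z p l s

/-- The residue of `ω_w^G` for `w ∈ 𝔚_p` in closed form. -/
noncomputable def residueTerm [P.IsRootSystem] (q : ℕ) (Z : ℂ → ℂ) (p : b.support)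
    (w : P.weylGroup) (s : ℂ) : ℂ :=
  (1 / (Real.log q : ℂ)) ^ Finset.card {i ∈ b.leviBase p | P.weylGroupToPerm w i ∈ b.support} *
    residueAt Z 1 ^ (b.inversionSet w ∩ b.leviBase p).card *
    (∏ i with P.weylGroupToPerm w i ∈ b.support ∧ i ∉ b.leviBase p,
      1 / (1 - (q : ℂ) ^ (-(b.corootCoeff p i * s) - b.corootHeight i + 1))) *
    (zetaProduct Z (b.zetaNumerator p w) s / zetaProduct Z (b.zetaDenominator p w) s)

end RootPairing.Base

/-!
Along the point `s λ_p`, every factor of `ω_w^G` is, up to a factor analytic there, either regular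
or a simple pole in one of the remaining coordinates `s_j`, `j ≠ p`. The coordinates in which a
pole occurs are the `j` with `w α_j ∈ Δ ∪ Φ⁻`, and taking the residue in a coordinate without a pole
gives `0`. So `ω_w^G` survives exactly if `w ∈ 𝔚_p`, and then the iterated residue is the product of
the values of the regular factors and the residues of the polar ones. What is needed of `ζ̂_X` is
that it is meromorphic with a simple pole at `1` and no zeros or poles for `Re s > 1`; this follows
from `|ω_i| ≤ q`, because the power sums of the `ω_i` are bounded by `#X(𝔽_{q^n}) + q^n + 1` and
Noether normalization gives `#X(𝔽_{q^n}) = O(q^n)`.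

The minimal family of zeta factors is the supremum over `w ∈ 𝔚_p` of the multisets by which the
denominators exceed the numerators. The roots of positive height in `w⁻¹Φ⁻` are those of `Φ_w`,
so its multiplicities are the maximal differences of the root counts `N_{p,w}`; they are
nonnegative because `w = 1` contributes `0`.
-/

/-! ### Simple poles and iterated residues -/

section SimplePole

/-- `f` has at most a simple pole at `a`, with residue `c`; thus `c = 0` if `f` is holomorphic
at `a`. -/
def HasSimplePoleAt (f : ℂ → ℂ) (a c : ℂ) : Prop :=
  ∃ h : ℂ → ℂ, AnalyticAt ℂ h a ∧ h a = c ∧ ∀ᶠ z in 𝓝[≠] a, (z - a) * f z = h z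

variable {f g : ℂ → ℂ} {a c d : ℂ}

open Filter in
theorem HasSimplePoleAt.residueAt_eq (hf : HasSimplePoleAt f a c) : residueAt f a = c := by
  obtain ⟨h, hh, rfl, hfh⟩ := hf
  obtain ⟨R, hR, hball⟩ := Metric.eventually_nhds_iff_ball.1
    (hh.eventually_analyticAt.and (eventually_nhdsWithin_iff.1 hfh))
  refine Tendsto.limUnder_eq (tendsto_const_nhds.congr' ?_)
  filter_upwards [Ioo_mem_nhdsGT hR] with r hr
  have hsub : Metric.closedBall a r ⊆ Metric.ball a R := Metric.closedBall_subset_ball hr.2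
  have hcongr : (∮ z in C(a, r), f z) = ∮ z in C(a, r), (z - a)⁻¹ • h z := by
    refine circleIntegral.integral_congr hr.1.le fun z hz => ?_
    have hza : z ≠ a := Metric.ne_of_mem_sphere hz hr.1.ne'
    rw [← (hball z (hsub (Metric.sphere_subset_closedBall hz))).2 hza, smul_eq_mul,
      inv_mul_cancel_left₀ (sub_ne_zero.2 hza)]
  have hcauchy : (∮ z in C(a, r), (z - a)⁻¹ • h z) = (2 * Real.pi * Complex.I) • h a :=
    DifferentiableOn.circleIntegral_sub_inv_smul
      (fun z hz => (hball z (hsub hz)).1.differentiableWithinAt) (Metric.mem_ball_self hr.1)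
  rw [hcongr, hcauchy, smul_eq_mul, inv_mul_cancel_left₀ Complex.two_pi_I_ne_zero]

theorem HasSimplePoleAt.mul_analyticAt (hf : HasSimplePoleAt f a c) (hg : AnalyticAt ℂ g a) :
    HasSimplePoleAt (fun z => f z * g z) a (c * g a) := by
  obtain ⟨h, hh, rfl, hfh⟩ := hf
  refine ⟨fun z => h z * g z, hh.mul hg, rfl, hfh.mono fun z hz => ?_⟩
  rw [← mul_assoc, hz]

theorem hasSimplePoleAt_inv (hf : AnalyticAt ℂ f a) (hfa : f a = 0) (hd : HasDerivAt f d a)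
    (hd0 : d ≠ 0) : HasSimplePoleAt (fun z => (f z)⁻¹) a d⁻¹ := by
  have hslope : AnalyticAt ℂ (dslope f a) a :=
    let ⟨p, hp⟩ := hf
    ⟨p.fslope, hp.has_fpower_series_dslope_fslope⟩
  have hslope_self : dslope f a a = d := by rw [dslope_same, hd.deriv]
  refine ⟨fun z => (dslope f a z)⁻¹, hslope.inv (hslope_self ▸ hd0), congrArg _ hslope_self, ?_⟩
  filter_upwards [self_mem_nhdsWithin] with z hz
  rw [dslope_of_ne f hz, slope_def_field, hfa, sub_zero, inv_div, div_eq_mul_inv]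

end SimplePole

section LeadingCoeff

variable {J : Type*}

theorem analyticAt_coord [Fintype J] (t₀ : J → ℂ) (j : J) :
    AnalyticAt ℂ (fun t : J → ℂ => t j) t₀ :=
  (ContinuousLinearMap.proj (R := ℂ) (φ := fun _ : J => ℂ) j).analyticAt t₀

theorem analyticAt_update [Fintype J] [DecidableEq J] {E : Type*} [NormedAddCommGroup E]
    [NormedSpace ℂ E] {x : E} {g : E → J → ℂ} {h : E → ℂ} (hg : AnalyticAt ℂ g x)
    (hh : AnalyticAt ℂ h x) (j : J) :
    AnalyticAt ℂ (fun y => Function.update (g y) j (h y)) x := by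
  refine AnalyticAt.pi fun i => ?_
  rcases eq_or_ne i j with rfl | hij
  · simpa only [Function.update_self] using hh
  · simp only [Function.update_of_ne hij]
    exact (analyticAt_coord (g x) i).comp hg

/-- Near `t₀`, the function `F` of several variables has at most simple poles along the hyperplanes
`t_j = 0` with `j ∈ L`, and `c` is the value at `t₀` of the holomorphic function extending
`(∏ j ∈ L, t_j) F(t)`. -/
def HasLeadingCoeffAt [Fintype J] (L : Finset J) (F : (J → ℂ) → ℂ) (t₀ : J → ℂ) (c : ℂ) : Prop :=
  ∃ H : (J → ℂ) → ℂ, AnalyticAt ℂ H t₀ ∧ H t₀ = c ∧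
    ∀ᶠ t in 𝓝 t₀, (∀ j ∈ L, t j ≠ 0) → (∏ j ∈ L, t j) * F t = H t

variable [Fintype J] {L L' : Finset J} {F G : (J → ℂ) → ℂ} {t₀ : J → ℂ} {c d : ℂ}

theorem hasLeadingCoeffAt_of_analyticAt (hF : AnalyticAt ℂ F t₀) :
    HasLeadingCoeffAt ∅ F t₀ (F t₀) :=
  ⟨F, hF, rfl, by simp⟩

theorem HasSimplePoleAt.hasLeadingCoeffAt {f : ℂ → ℂ} {a : ℂ} (hf : HasSimplePoleAt f a c) {j : J}
    (hj : t₀ j = 0) : HasLeadingCoeffAt {j} (fun t => f (a + t j)) t₀ c := by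
  obtain ⟨h, hh, rfl, hfh⟩ := hf
  have hline : AnalyticAt ℂ (fun t : J → ℂ => a + t j) t₀ :=
    analyticAt_const.add (analyticAt_coord t₀ j)
  have hline₀ : a + t₀ j = a := by rw [hj, add_zero]
  refine ⟨fun t => h (a + t j), hh.comp_of_eq hline hline₀, congrArg h hline₀, ?_⟩
  have htendsto : Filter.Tendsto (fun t : J → ℂ => a + t j) (𝓝 t₀) (𝓝 a) := by
    simpa only [ContinuousAt, hline₀] using hline.continuousAt
  filter_upwards [htendsto.eventually (eventually_nhdsWithin_iff.1 hfh)] with t ht hne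
  simpa using ht (by simpa using hne j (Finset.mem_singleton_self j))

theorem HasLeadingCoeffAt.mul [DecidableEq J] (hF : HasLeadingCoeffAt L F t₀ c)
    (hG : HasLeadingCoeffAt L' G t₀ d) (hL : Disjoint L L') :
    HasLeadingCoeffAt (L ∪ L') (fun t => F t * G t) t₀ (c * d) := by
  obtain ⟨H, hH, rfl, hFH⟩ := hF
  obtain ⟨K, hK, rfl, hGK⟩ := hG
  refine ⟨fun t => H t * K t, hH.mul hK, rfl, ?_⟩
  filter_upwards [hFH, hGK] with t htF htG hne
  rw [Finset.prod_union hL, mul_mul_mul_comm,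
    htF fun j hj => hne j (Finset.mem_union_left _ hj),
    htG fun j hj => hne j (Finset.mem_union_right _ hj)]

theorem HasLeadingCoeffAt.prod [DecidableEq J] {I : Type*} {s : Finset I} {L : I → Finset J}
    {F : I → (J → ℂ) → ℂ} {c : I → ℂ} (hF : ∀ i ∈ s, HasLeadingCoeffAt (L i) (F i) t₀ (c i))
    (hL : (s : Set I).PairwiseDisjoint L) :
    HasLeadingCoeffAt (s.biUnion L) (fun t => ∏ i ∈ s, F i t) t₀ (∏ i ∈ s, c i) := by
  classical
  induction s using Finset.induction_on with
  | empty => simpa using hasLeadingCoeffAt_of_analyticAt (analyticAt_const (v := (1 : ℂ)) (x := t₀))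
  | insert i s hi ih =>
    simp only [Finset.biUnion_insert, Finset.prod_insert hi]
    refine (hF i (s.mem_insert_self i)).mul
      (ih (fun j hj => hF j (Finset.mem_insert_of_mem hj)) (hL.subset (by simp)))
      ((Finset.disjoint_biUnion_right _ _ _).2 fun j hj => ?_)
    exact hL (by simp) (by simp [hj]) (ne_of_mem_of_not_mem hj hi).symm

theorem HasLeadingCoeffAt.sum {I : Type*} {s : Finset I} {F : I → (J → ℂ) → ℂ} {c : I → ℂ}
    (hF : ∀ i ∈ s, HasLeadingCoeffAt L (F i) t₀ (c i)) :
    HasLeadingCoeffAt L (fun t => ∑ i ∈ s, F i t) t₀ (∑ i ∈ s, c i) := by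
  choose! H hH hHc hFH using hF
  refine ⟨fun t => ∑ i ∈ s, H i t, Finset.analyticAt_fun_sum s hH, Finset.sum_congr rfl hHc, ?_⟩
  filter_upwards [s.eventually_all.2 hFH] with t ht hne
  rw [Finset.mul_sum]
  exact Finset.sum_congr rfl fun i hi => ht i hi hne

theorem HasLeadingCoeffAt.zero_of_ssubset (hF : HasLeadingCoeffAt L F t₀ c) (hL : L ⊂ L')
    (h₀ : ∀ j ∈ L', t₀ j = 0) : HasLeadingCoeffAt L' F t₀ 0 := by
  classical
  obtain ⟨H, hH, -, hFH⟩ := hF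
  obtain ⟨j, hj, hjL⟩ := Finset.exists_of_ssubset hL
  refine ⟨fun t => (∏ j ∈ L' \ L, t j) * H t,
    (Finset.analyticAt_fun_prod _ fun i _ => analyticAt_coord t₀ i).mul hH, ?_, ?_⟩
  · exact mul_eq_zero_of_left (Finset.prod_eq_zero (Finset.mem_sdiff.2 ⟨hj, hjL⟩) (h₀ j hj)) _
  · filter_upwards [hFH] with t ht hne
    rw [← ht fun i hi => hne i (hL.1 hi), ← mul_assoc, Finset.prod_sdiff hL.1]

variable [DecidableEq J]

theorem HasLeadingCoeffAt.residueAt_update {j : J} (hj : j ∉ L) (hj₀ : t₀ j = 0)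
    (hF : HasLeadingCoeffAt (insert j L) F t₀ c) :
    HasLeadingCoeffAt L (fun t => residueAt (fun z => F (Function.update t j z)) 0) t₀ c := by
  obtain ⟨H, hH, rfl, hFH⟩ := hF
  have hupdate₀ : Function.update t₀ j 0 = t₀ := by rw [← hj₀, Function.update_eq_self]
  have hupdate : AnalyticAt ℂ (fun t : J → ℂ => Function.update t j (0 : ℂ)) t₀ :=
    analyticAt_update analyticAt_id analyticAt_const j
  have htendsto : Filter.Tendsto (fun t : J → ℂ => Function.update t j (0 : ℂ)) (𝓝 t₀) (𝓝 t₀) := by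
    simpa only [ContinuousAt, hupdate₀] using hupdate.continuousAt
  refine ⟨fun t => H (Function.update t j 0), hH.comp_of_eq hupdate hupdate₀,
    congrArg H hupdate₀, ?_⟩
  filter_upwards [htendsto.eventually hFH.eventually_nhds,
    htendsto.eventually hH.eventually_analyticAt] with t ht hHt hne
  have hline : AnalyticAt ℂ (fun z : ℂ => Function.update t j z) 0 :=
    analyticAt_update analyticAt_const analyticAt_id j
  have hprod : ∏ i ∈ L, t i ≠ 0 := Finset.prod_ne_zero_iff.2 hne
  have hpole : HasSimplePoleAt (fun z => F (Function.update t j z)) 0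
      ((∏ i ∈ L, t i)⁻¹ * H (Function.update t j 0)) := by
    refine ⟨fun z => (∏ i ∈ L, t i)⁻¹ * H (Function.update t j z),
      analyticAt_const.mul (hHt.fun_comp hline), rfl, ?_⟩
    filter_upwards [nhdsWithin_le_nhds (hline.continuousAt.eventually ht), self_mem_nhdsWithin]
      with z hz hz₀
    have hne' : ∀ i ∈ insert j L, Function.update t j z i ≠ 0 := by
      refine Finset.forall_mem_insert _ _ _ |>.2 ⟨by simpa using hz₀, fun i hi => ?_⟩
      rw [Function.update_of_ne (ne_of_mem_of_not_mem hi hj)]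
      exact hne i hi
    rw [← hz hne', Finset.prod_insert hj, Finset.prod_update_of_notMem hj, Function.update_self]
    field_simp
    ring
  rw [hpole.residueAt_eq, mul_inv_cancel_left₀ hprod]

theorem HasLeadingCoeffAt.iteratedResidue_eq {l : List J} (hl : l.Nodup) (h₀ : ∀ j ∈ l, t₀ j = 0)
    (hF : HasLeadingCoeffAt l.toFinset F t₀ c) : iteratedResidue l F t₀ = c := by
  induction l generalizing F with
  | nil =>
    obtain ⟨H, -, rfl, hFH⟩ := hF
    simpa [iteratedResidue] using hFH.self_of_nhds
  | cons j l ih =>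
    rw [List.toFinset_cons] at hF
    exact ih hl.of_cons (fun i hi => h₀ i (List.mem_cons_of_mem j hi))
      (hF.residueAt_update (by simpa using hl.notMem) (h₀ j List.mem_cons_self))

end LeadingCoeff

/-! ### Zeta functions -/

section ZetaLike

theorem eventually_codiscrete_affine {p : ℂ → Prop} (hp : ∀ᶠ s in Filter.codiscrete ℂ, p s)
    (a c : ℂ) (h₀ : a = 0 → p c) : ∀ᶠ s in Filter.codiscrete ℂ, p (a * s + c) := by
  rcases eq_or_ne a 0 with rfl | ha
  · simp [h₀ rfl]
  have hp' : ∀ x, ∀ᶠ s in 𝓝[≠] x, p s := by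
    simpa only [Filter.Eventually, mem_codiscrete, Filter.disjoint_principal_right, compl_compl]
      using hp
  suffices h : ∀ x, ∀ᶠ s in 𝓝[≠] x, p (a * s + c) by
    simpa only [Filter.Eventually, mem_codiscrete, Filter.disjoint_principal_right, compl_compl]
      using h
  intro x
  have hcont : ContinuousWithinAt (fun s => a * s + c) {x}ᶜ x := by fun_prop
  have hmaps : Set.MapsTo (fun s => a * s + c) {x}ᶜ {a * x + c}ᶜ := fun z hz => by
    simpa [ha] using hz
  exact (hcont.tendsto_nhdsWithin hmaps).eventually (hp' _)

/-- The properties of a complete zeta function that determine the residues of periods: it is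
generically holomorphic without zeros, it is so on the half-plane `Re s > 1`, and it has at most a
simple pole at `1`. -/
structure IsZetaLike (Z : ℂ → ℂ) : Prop where
  generic : ∀ᶠ s in Filter.codiscrete ℂ, AnalyticAt ℂ Z s ∧ Z s ≠ 0
  regular : ∀ s : ℂ, 1 < s.re → AnalyticAt ℂ Z s ∧ Z s ≠ 0
  pole : ∃ c, HasSimplePoleAt Z 1 c

variable {Z : ℂ → ℂ}

theorem IsZetaLike.eventually_affine (hZ : IsZetaLike Z) {a c : ℂ} (hc : a = 0 → 1 < c.re) :
    ∀ᶠ s in Filter.codiscrete ℂ, AnalyticAt ℂ Z (a * s + c) ∧ Z (a * s + c) ≠ 0 :=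
  eventually_codiscrete_affine hZ.generic a c fun ha => hZ.regular c (hc ha)

theorem IsZetaLike.hasSimplePoleAt_one (hZ : IsZetaLike Z) :
    HasSimplePoleAt Z 1 (residueAt Z 1) := by
  obtain ⟨c, hc⟩ := hZ.pole
  rwa [hc.residueAt_eq]

variable {q : ℕ} {a s : ℂ}

theorem analyticAt_natCast_cpow (hq : q ≠ 0) {E : Type*} [NormedAddCommGroup E] [NormedSpace ℂ E]
    {f : E → ℂ} {x : E} (hf : AnalyticAt ℂ f x) : AnalyticAt ℂ (fun y => (q : ℂ) ^ f y) x :=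
  analyticAt_const.cpow hf (Complex.natCast_mem_slitPlane.2 hq)

theorem analyticAt_one_sub_mul_cpow_neg (hq : q ≠ 0) (a s : ℂ) :
    AnalyticAt ℂ (fun z : ℂ => 1 - a * (q : ℂ) ^ (-z)) s :=
  analyticAt_const.sub (analyticAt_const.mul (analyticAt_natCast_cpow hq analyticAt_id.neg))

theorem eventually_one_sub_mul_cpow_neg_ne_zero (hq : 1 < q) (a : ℂ) :
    ∀ᶠ s in Filter.codiscrete ℂ, 1 - a * (q : ℂ) ^ (-s) ≠ 0 := by
  have hana : AnalyticOnNhd ℂ (fun s : ℂ => 1 - a * (q : ℂ) ^ (-s)) Set.univ := fun s _ =>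
    analyticAt_one_sub_mul_cpow_neg (by lia) a s
  have hex : ∃ x : ℂ, 1 - a * (q : ℂ) ^ (-x) ≠ 0 := by
    by_contra! h
    have ha : 1 - a = 0 := by simpa using h 0
    have haq : 1 - a * q = 0 := by simpa using h (-1)
    have hq1 : (q : ℂ) = 1 := by linear_combination q * ha - haq
    exact hq.ne' (by exact_mod_cast hq1)
  exact hana.preimage_zero_mem_codiscrete hex.choose_spec

theorem one_sub_mul_cpow_neg_ne_zero (hq : 0 < q) (ha : ‖a‖ < (q : ℝ) ^ s.re) :
    1 - a * (q : ℂ) ^ (-s) ≠ 0 := by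
  intro h
  have hnorm : ‖a * (q : ℂ) ^ (-s)‖ < 1 := by
    rw [norm_mul, Complex.norm_natCast_cpow_of_pos hq, Complex.neg_re,
      Real.rpow_neg (Nat.cast_nonneg q), ← div_eq_mul_inv, div_lt_one (by positivity)]
    exact ha
  rw [← sub_eq_zero.1 h, norm_one] at hnorm
  exact hnorm.false

theorem one_sub_natCast_mul_cpow_neg_intCast_ne_zero (hq : 1 < q) {m : ℤ} (hm : m ≠ 1) :
    1 - (q : ℂ) * (q : ℂ) ^ (-(m : ℂ)) ≠ 0 := by
  have hq₀ : (q : ℂ) ≠ 0 := Nat.cast_ne_zero.2 (by lia)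
  rw [← Int.cast_neg, Complex.cpow_intCast, ← zpow_one_add₀ hq₀, sub_ne_zero]
  intro h
  have hnorm : (q : ℝ) ^ (1 + -m) = 1 := by simpa using (congrArg norm h).symm
  have hexp := (zpow_eq_one_iff_right₀ (by positivity) (by exact_mod_cast hq.ne')).1 hnorm
  lia

theorem hasSimplePoleAt_inv_one_sub_mul_cpow_neg (hq : 1 < q) (has : a * (q : ℂ) ^ (-s) = 1) :
    HasSimplePoleAt (fun z => (1 - a * (q : ℂ) ^ (-z))⁻¹) s (Real.log q : ℂ)⁻¹ := by
  have hq₀ : (q : ℂ) ≠ 0 := Nat.cast_ne_zero.2 (by lia)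
  refine hasSimplePoleAt_inv (analyticAt_one_sub_mul_cpow_neg (by lia) a s)
    (by rw [has, sub_self]) ?_ (by exact_mod_cast (Real.log_pos (by exact_mod_cast hq)).ne')
  refine ((((hasDerivAt_neg' s).const_cpow (Or.inl hq₀)).const_mul a).const_sub 1).congr_deriv ?_
  rw [Complex.ofReal_log (Nat.cast_nonneg q), Complex.ofReal_natCast]
  linear_combination Complex.log q * has

end ZetaLike

section WeilZeta

variable {q : ℕ} {c : ℂ} {ι : Type*} [Fintype ι] {ω : ι → ℂ}

/-- The function `q^{cs} ∏ (1 - ω_i q^{-s}) / ((1 - q^{-s}) (1 - q q^{-s}))`, which is the complete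
Artin zeta function of a curve of genus `g` over a field with `q` elements if `c = g - 1` and the
`ω_i` are its Frobenius eigenvalues. -/
noncomputable def weilZeta (q : ℕ) (c : ℂ) (ω : ι → ℂ) (s : ℂ) : ℂ :=
  (q : ℂ) ^ (c * s) * ((∏ i, (1 - ω i * (q : ℂ) ^ (-s))) /
    ((1 - (q : ℂ) ^ (-s)) * (1 - (q : ℂ) * (q : ℂ) ^ (-s))))

theorem analyticAt_weilZeta_numerator (hq : q ≠ 0) (c : ℂ) (ω : ι → ℂ) (s : ℂ) :
    AnalyticAt ℂ (fun z => (q : ℂ) ^ (c * z) * ∏ i, (1 - ω i * (q : ℂ) ^ (-z))) s :=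
  (analyticAt_natCast_cpow hq (analyticAt_const.mul analyticAt_id)).mul
    (Finset.analyticAt_fun_prod _ fun i _ => analyticAt_one_sub_mul_cpow_neg hq (ω i) s)

theorem analyticAt_weilZeta_and_ne_zero (hq : q ≠ 0) {s : ℂ}
    (hω : ∀ i, 1 - ω i * (q : ℂ) ^ (-s) ≠ 0) (h₁ : 1 - 1 * (q : ℂ) ^ (-s) ≠ 0)
    (hq₁ : 1 - (q : ℂ) * (q : ℂ) ^ (-s) ≠ 0) :
    AnalyticAt ℂ (weilZeta q c ω) s ∧ weilZeta q c ω s ≠ 0 := by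
  have hweil : weilZeta q c ω = fun z => ((q : ℂ) ^ (c * z) * ∏ i, (1 - ω i * (q : ℂ) ^ (-z))) /
      ((1 - 1 * (q : ℂ) ^ (-z)) * (1 - (q : ℂ) * (q : ℂ) ^ (-z))) := by
    funext z
    rw [weilZeta, one_mul, mul_div_assoc]
  have hlead : (q : ℂ) ^ (c * s) ≠ 0 := fun h =>
    hq (by exact_mod_cast ((Complex.cpow_eq_zero_iff _ _).1 h).1)
  rw [hweil]
  exact ⟨(analyticAt_weilZeta_numerator hq c ω s).div
    ((analyticAt_one_sub_mul_cpow_neg hq 1 s).mul (analyticAt_one_sub_mul_cpow_neg hq q s))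
    (mul_ne_zero h₁ hq₁),
    div_ne_zero (mul_ne_zero hlead (Finset.prod_ne_zero_iff.2 fun i _ => hω i))
      (mul_ne_zero h₁ hq₁)⟩

theorem exists_hasSimplePoleAt_weilZeta (hq : 1 < q) (c : ℂ) (ω : ι → ℂ) :
    ∃ r, HasSimplePoleAt (weilZeta q c ω) 1 r := by
  have hq₀ : q ≠ 0 := by lia
  have hone : 1 - 1 * (q : ℂ) ^ (-(1 : ℂ)) ≠ 0 :=
    one_sub_mul_cpow_neg_ne_zero (by lia) (by simpa using hq)
  have hq₁ : (q : ℂ) * (q : ℂ) ^ (-(1 : ℂ)) = 1 := by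
    rw [Complex.cpow_neg_one, mul_inv_cancel₀ (Nat.cast_ne_zero.2 hq₀)]
  have hpole := (hasSimplePoleAt_inv_one_sub_mul_cpow_neg hq hq₁).mul_analyticAt
    ((analyticAt_weilZeta_numerator hq₀ c ω 1).div
      (analyticAt_one_sub_mul_cpow_neg hq₀ 1 1) hone)
  refine ⟨_, Eq.subst (motive := fun Z => HasSimplePoleAt Z 1 _) ?_ hpole⟩
  funext z
  simp only [weilZeta, Pi.div_apply, one_mul, div_eq_mul_inv, mul_inv]
  ring

theorem isZetaLike_weilZeta (hq : 1 < q) (hω : ∀ i, ‖ω i‖ ≤ q) : IsZetaLike (weilZeta q c ω) where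
  generic := by
    filter_upwards [Filter.eventually_all.2 fun i =>
        eventually_one_sub_mul_cpow_neg_ne_zero hq (ω i),
      eventually_one_sub_mul_cpow_neg_ne_zero hq 1, eventually_one_sub_mul_cpow_neg_ne_zero hq q]
      with s hs h₁ hq₁
    exact analyticAt_weilZeta_and_ne_zero (by lia) hs h₁ hq₁
  regular s hs := by
    have hlt : (q : ℝ) < (q : ℝ) ^ s.re := by
      simpa using Real.rpow_lt_rpow_of_exponent_lt (by exact_mod_cast hq : (1 : ℝ) < q) hs
    have hne (a : ℂ) (ha : ‖a‖ ≤ q) : 1 - a * (q : ℂ) ^ (-s) ≠ 0 :=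
      one_sub_mul_cpow_neg_ne_zero (by lia) (ha.trans_lt hlt)
    exact analyticAt_weilZeta_and_ne_zero (by lia) (fun i => hne _ (hω i))
      (hne 1 (by simpa using hq.le)) (hne q (by simp))
  pole := exists_hasSimplePoleAt_weilZeta hq c ω

end WeilZeta

/-! ### Coroot heights and coroot coordinates -/

section RootSystem

open RootPairing RootPairing.Base

section RootPairing

variable {ι R M N : Type*} [CommRing R] [AddCommGroup M] [Module R M] [AddCommGroup N] [Module R N]
  {P : RootPairing ι R M N}

theorem toLinearMap_weylGroup_smul_coroot (w : P.weylGroup) (x : M) (i : ι) :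
    P.toLinearMap (w • x) (P.coroot i) =
      P.toLinearMap x (P.coroot ((P.weylGroupToPerm w).symm i)) := by
  have h := Hom.weight_coweight_transpose_apply P P (P.coroot i) (w : Aut P).toHom
  rw [Hom.coroot_coweightMap_apply] at h
  exact LinearMap.congr_fun h x

theorem weylGroupToPerm_injective [P.IsRootSystem] : Function.Injective P.weylGroupToPerm := by
  refine fun v w h => Subtype.ext (Equiv.weightHom_injective P (LinearEquiv.toLinearMap_injective
    (LinearMap.ext_on_range (v := P.root) IsRootSystem.span_root_eq_top fun i => ?_)))
  exact (P.weylGroup_apply_root v i).trans (h ▸ (P.weylGroup_apply_root w i).symm)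

instance finite_weylGroup [Finite ι] [P.IsRootSystem] : Finite P.weylGroup :=
  Finite.of_injective _ weylGroupToPerm_injective

end RootPairing

section Positivity

variable {ι R M N : Type*} [Field R] [CharZero R] [AddCommGroup M] [Module R M]
  [AddCommGroup N] [Module R N] {P : RootPairing ι R M N} {b : P.Base} {i j : ι}

theorem reflectionPerm_ne_of_isPos (hi : b.IsPos i) (hj : b.IsPos j) :
    P.reflectionPerm j i ≠ j := by
  intro h
  have hneg : i = P.reflectionPerm j j := by rw [← P.reflectionPerm_self j i, h]
  exact (IsPos.neg_iff_not b j).1 (by rwa [hneg] at hi) hj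

variable [Finite ι] [P.IsCrystallographic]

theorem mem_support_of_height_eq_one (hi : b.height i = 1) : i ∈ b.support := by
  have hpos : b.IsPos i := b.isPos_iff.2 (hi ▸ one_pos)
  obtain ⟨j, hj, hij⟩ := hpos.exists_mem_support_pos_pairingIn
  by_contra his
  obtain ⟨k, hk⟩ := P.root_sub_root_mem_of_pairingIn_pos ((P.zero_lt_pairingIn_iff' ℤ).1 hij)
    (ne_of_mem_of_not_mem hj his).symm
  exact b.height_ne_zero k (by rw [b.height_sub hk, hi, height_one_of_mem_support hj, sub_self])

variable [P.IsReduced]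

theorem isPos_flip (hi : b.IsPos i) : b.flip.IsPos i := by
  refine hi.induction_on_reflect (p := fun i => b.IsPos i → b.flip.IsPos i)
    (fun j hj _ => isPos_of_mem_support (b := b.flip) hj) (fun i j ih hj hpos => ?_) hi
  rcases eq_or_ne (P.reflectionPerm j i) j with h | h
  · rw [h]
    exact isPos_of_mem_support (b := b.flip) hj
  · have hi : b.IsPos i := by simpa using hpos.reflectionPerm hj h
    have hij : i ≠ j := by
      rintro rfl
      exact (IsPos.neg_iff_not b i).1 hpos hi
    exact (ih hi).reflectionPerm (b := b.flip) hj hij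

theorem isPos_iff_flip_height_pos : b.IsPos i ↔ 0 < b.flip.height i :=
  ⟨isPos_flip, isPos_flip (b := b.flip)⟩

end Positivity

section CorootCoordinates

variable {ι M N : Type*} [AddCommGroup M] [Module ℂ M] [AddCommGroup N] [Module ℂ N]
  {P : RootPairing ι ℂ M N} {b : P.Base} {i j : ι}

theorem corootCoeff_of_mem_support [DecidableEq ι] [P.IsRootSystem] (p : b.support)
    (hi : i ∈ b.support) : b.corootCoeff p i = if i = p then 1 else 0 := by
  have hcoord : P.toLinearMap (b.fundamentalWeight p) = b.toCoweightBasis.coord p :=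
    LinearEquiv.apply_symm_apply P.toLinearMap.toPerfPair _
  rw [corootCoeff, hcoord, Module.Basis.coord_apply, toCoweightBasis_repr_coroot b ⟨i, hi⟩,
    Finsupp.single_apply]
  simp only [Subtype.ext_iff]

theorem exists_corootCoeff_eq_natCast [Finite ι] [P.IsCrystallographic] [P.IsReduced]
    [P.IsRootSystem] (p : b.support) (hi : b.IsPos i) :
    ∃ a : ℕ, b.corootCoeff p i = a := by
  classical
  refine (isPos_flip hi).induction_on_add (p := fun i => ∃ a : ℕ, b.corootCoeff p i = a)
    (fun j hj => ?_) fun i j k hk ⟨a, ha⟩ hj => ?_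
  · refine ⟨if j = p then 1 else 0, ?_⟩
    rw [corootCoeff_of_mem_support p hj, Nat.cast_ite, Nat.cast_one, Nat.cast_zero]
  · have hk' : P.coroot k = P.coroot i + P.coroot j := hk
    refine ⟨a + if j = p then 1 else 0, ?_⟩
    rw [Nat.cast_add, ← ha, Nat.cast_ite, Nat.cast_one, Nat.cast_zero,
      ← corootCoeff_of_mem_support p hj, corootCoeff, hk', map_add]
    rfl

variable [Fintype ι]

theorem toLinearMap_weightOfCoord_coroot [P.IsRootSystem] (t : b.support → ℂ) (i : ι) :
    P.toLinearMap (b.weightOfCoord t) (P.coroot i) =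
      b.corootHeight i + ∑ j, t j * b.corootCoeff j i := by
  simp [weightOfCoord, corootHeight, corootCoeff, map_sum, LinearMap.sum_apply]

variable [P.IsCrystallographic] [P.IsReduced]

theorem corootHeight_of_mem_support (hj : j ∈ b.support) : b.corootHeight j = 1 := by
  classical
  have hj' : b.IsPos j := isPos_of_mem_support hj
  have hneg (i : ι) : P.pairing (P.reflectionPerm j i) j = -P.pairing i j := by
    rw [← pairing_reflectionPerm, pairing_reflectionPerm_self_right]
  -- the simple reflection `s_j` permutes the positive roots other than `α_j`
  have hothers : ∑ i ∈ (Finset.univ.filter b.IsPos).erase j, P.pairing i j = 0 := by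
    refine Finset.sum_involution (fun i _ => P.reflectionPerm j i) (fun i _ => ?_)
      (fun i _ hi h => hi ?_) (fun i hi => ?_) (fun i _ => P.reflectionPerm_self j i)
    · rw [hneg, add_neg_cancel]
    · rw [← self_eq_neg, ← hneg, h]
    · simp only [Finset.mem_erase, Finset.mem_filter, Finset.mem_univ, true_and] at hi ⊢
      exact ⟨reflectionPerm_ne_of_isPos hi.2 hj', hi.2.reflectionPerm hj hi.1⟩
  have hsum : ∑ i with b.IsPos i, P.pairing i j = 2 := by
    rw [← Finset.add_sum_erase _ _ (by simpa using hj' : j ∈ Finset.univ.filter b.IsPos),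
      hothers, P.pairing_same, add_zero]
  have hexpand : b.corootHeight j = 2⁻¹ * ∑ i with b.IsPos i, P.pairing i j := by
    simp [corootHeight, weylVector, map_sum, LinearMap.sum_apply]
  rw [hexpand, hsum, inv_mul_cancel₀ two_ne_zero]

theorem corootHeight_eq_flip_height (i : ι) : b.corootHeight i = b.flip.height i := by
  refine b.flip.induction_add i (p := fun i => b.corootHeight i = b.flip.height i)
    (fun i ih => ?_) (fun j hj => ?_) (fun i j k hk ih hj => ?_)
  · have hheight : b.flip.height (P.reflectionPerm i i) = -b.flip.height i :=
      b.flip.height_reflectionPerm_self i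
    have hcoroot : b.corootHeight (P.reflectionPerm i i) = -b.corootHeight i := by
      simp [corootHeight]
    exact hcoroot.trans (by rw [ih, ← Int.cast_neg]; exact congrArg Int.cast hheight.symm)
  · rw [corootHeight_of_mem_support (b := b) hj, height_one_of_mem_support hj, Int.cast_one]
  · have hk' : P.coroot k = P.coroot i + P.coroot j := hk
    rw [b.flip.height_add hk, Int.cast_add, ← ih, height_one_of_mem_support (b := b.flip) hj,
      Int.cast_one, ← corootHeight_of_mem_support (b := b) hj, corootHeight, hk', map_add]
    rfl

theorem isPos_iff_of_corootHeight_eq {i : ι} {h : ℤ} (hi : b.corootHeight i = h) :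
    b.IsPos i ↔ 0 < h := by
  rw [isPos_iff_flip_height_pos,
    Int.cast_injective (α := ℂ) ((corootHeight_eq_flip_height i).symm.trans hi)]

end CorootCoordinates

end RootSystem

/-! ### Normalizing zeta factors -/

section ZetaProduct

open RootPairing.Base

theorem mulSupport_pow_count_subset {α β : Type*} [DecidableEq α] [Monoid β] (m : Multiset α)
    (f : α → β) : (Function.mulSupport fun x => f x ^ m.count x) ⊆ m.toFinset := by
  refine Function.mulSupport_subset_iff'.2 fun x hx => ?_
  rw [Multiset.count_eq_zero_of_notMem (by simpa using hx), pow_zero]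

theorem multisetProd_map_eq_finprod {α β : Type*} [DecidableEq α] [CommMonoid β] (m : Multiset α)
    (f : α → β) : (m.map f).prod = ∏ᶠ x, f x ^ m.count x := by
  rw [Finset.prod_multiset_map_count,
    finprod_eq_prod_of_mulSupport_subset _ (mulSupport_pow_count_subset m f)]

theorem zetaProduct_map_natCast (Z : ℂ → ℂ) (m : Multiset (ℕ × ℕ)) (s : ℂ) :
    zetaProduct Z (m.map (Prod.map Nat.cast Nat.cast)) s =
      ∏ᶠ (a : ℕ) (c : ℕ), Z (a * s + c) ^ m.count (a, c) := by
  rw [zetaProduct, Multiset.map_map, multisetProd_map_eq_finprod,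
    finprod_curry _ (m.toFinset.finite_toSet.subset (mulSupport_pow_count_subset m _))]
  rfl

end ZetaProduct

section NormalizingFactors

open RootPairing RootPairing.Base

open scoped Classical

variable {ι M N : Type*} [Fintype ι] [AddCommGroup M] [Module ℂ M] [AddCommGroup N] [Module ℂ N]
  {P : RootPairing ι ℂ M N} {b : P.Base} {p : b.support}

theorem mem_inversionSet {w : P.weylGroup} {i : ι} :
    i ∈ b.inversionSet w ↔ b.IsPos i ∧ ¬ b.IsPos (P.weylGroupToPerm w i) := by
  simp [inversionSet]

omit [Fintype ι] in
theorem one_mem_specialWeyl : (1 : P.weylGroup) ∈ b.specialWeyl p := by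
  intro j hj
  rw [map_one]
  exact Or.inl (Finset.mem_of_mem_erase hj)

variable [P.IsRootSystem]

/-- The least multiset of zeta factors that clears the denominators of all terms: the supremum over
`𝔚_p` of the zeta factors left in the denominator after cancellation. -/
noncomputable def leastFactors (b : P.Base) (p : b.support) : Multiset (ℂ × ℂ) :=
  (Set.toFinite (b.specialWeyl p)).toFinset.sup fun w =>
    b.zetaDenominator p w - b.zetaNumerator p w

theorem clearsDenominators_iff {m : Multiset (ℂ × ℂ)} :
    b.ClearsDenominators p m ↔ leastFactors b p ≤ m := by
  simp [ClearsDenominators, leastFactors, Finset.sup_le_iff, tsub_le_iff_right]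

theorem isMinimalNormalization_iff {m : Multiset (ℂ × ℂ)} :
    b.IsMinimalNormalization p m ↔ m = leastFactors b p := by
  simp only [IsMinimalNormalization, clearsDenominators_iff]
  constructor
  · rintro ⟨hle, hmin⟩
    exact (Multiset.eq_of_le_of_card_le hle (hmin _ le_rfl)).symm
  · rintro rfl
    exact ⟨le_rfl, fun _ => Multiset.card_le_card⟩

theorem existsUnique_isMinimalNormalization : ∃! m, b.IsMinimalNormalization p m := by
  simp only [isMinimalNormalization_iff, existsUnique_eq]

theorem minimalFactors_eq_leastFactors : b.minimalFactors p = leastFactors b p :=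
  isMinimalNormalization_iff.1 (Classical.epsilon_spec existsUnique_isMinimalNormalization.exists)

theorem exists_mem_inversionSet_of_mem_leastFactors {x : ℂ × ℂ} (hx : x ∈ leastFactors b p) :
    ∃ w, ∃ i ∈ b.inversionSet w, (b.corootCoeff p i, b.corootHeight i + 1) = x := by
  rw [← Multiset.count_pos, leastFactors, Multiset.count_finset_sup, Finset.lt_sup_iff] at hx
  obtain ⟨w, -, hx⟩ := hx
  exact ⟨w, Multiset.mem_map.1 (Multiset.mem_of_le (Multiset.sub_le_self _ _)
    (Multiset.count_pos.1 hx))⟩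

variable [P.IsCrystallographic] [P.IsReduced]

theorem exists_eq_natCast_of_mem_leastFactors {x : ℂ × ℂ} (hx : x ∈ leastFactors b p) :
    ∃ a c : ℕ, 2 ≤ c ∧ x = ((a : ℂ), (c : ℂ)) := by
  obtain ⟨w, i, hi, rfl⟩ := exists_mem_inversionSet_of_mem_leastFactors hx
  have hpos : b.IsPos i := (mem_inversionSet.1 hi).1
  obtain ⟨a, ha⟩ := exists_corootCoeff_eq_natCast p hpos
  obtain ⟨h, hh⟩ := Int.eq_ofNat_of_zero_le (isPos_iff_flip_height_pos.1 hpos).le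
  have hh₀ : 0 < h := by exact_mod_cast hh ▸ isPos_iff_flip_height_pos.1 hpos
  refine ⟨a, h + 1, by lia, Prod.ext ha ?_⟩
  simp [corootHeight_eq_flip_height, hh]

theorem count_zetaDenominator (w : P.weylGroup) {a c : ℕ} (hc : 2 ≤ c) :
    (b.zetaDenominator p w).count ((a : ℂ), (c : ℂ)) = b.countN p w a (c - 1) := by
  rw [zetaDenominator, Multiset.count_map, countN, Finset.card_def, ← Finset.filter_val]
  congr 2
  ext i
  simp only [Finset.mem_filter, Finset.mem_univ, true_and, mem_inversionSet, Prod.mk.injEq]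
  constructor
  · rintro ⟨⟨-, hneg⟩, hcoeff, hheight⟩
    exact ⟨hneg, hcoeff.symm, by push_cast; linear_combination -hheight⟩
  · rintro ⟨hneg, hcoeff, hheight⟩
    refine ⟨⟨(isPos_iff_of_corootHeight_eq hheight).2 (by lia), hneg⟩, hcoeff.symm, ?_⟩
    push_cast at hheight
    linear_combination -hheight

theorem count_zetaNumerator (w : P.weylGroup) {a c : ℕ} (hc : 2 ≤ c) :
    (b.zetaNumerator p w).count ((a : ℂ), (c : ℂ)) = b.countN p w a c := by
  rw [zetaNumerator, Multiset.count_map, countN, Finset.card_def, ← Finset.filter_val]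
  congr 2
  ext i
  simp only [Finset.mem_filter, Finset.mem_sdiff, Finset.mem_univ, true_and, mem_inversionSet,
    Prod.mk.injEq]
  constructor
  · rintro ⟨⟨⟨-, hneg⟩, -⟩, hcoeff, hheight⟩
    exact ⟨hneg, hcoeff.symm, hheight.symm⟩
  · rintro ⟨hneg, hcoeff, hheight⟩
    refine ⟨⟨⟨(isPos_iff_of_corootHeight_eq hheight).2 (by lia), hneg⟩, fun hi => ?_⟩,
      hcoeff.symm, hheight.symm⟩
    rw [corootHeight_of_mem_support (Finset.mem_of_mem_erase hi)] at hheight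
    have hc₁ : (1 : ℤ) = c := by exact_mod_cast hheight
    lia

theorem countN_one_of_pos (k : ℤ) {h : ℤ} (hh : 0 < h) : b.countN p 1 k h = 0 := by
  rw [countN, Finset.card_eq_zero, Finset.filter_eq_empty_iff]
  rintro i - ⟨hneg, -, hheight⟩
  rw [map_one, Equiv.Perm.one_apply, isPos_iff_of_corootHeight_eq hheight] at hneg
  exact hneg hh

theorem count_leastFactors (a : ℕ) {c : ℕ} (hc : 2 ≤ c) :
    ((leastFactors b p).count ((a : ℂ), (c : ℂ)) : ℤ) = b.countM p a c := by
  set D : P.weylGroup → ℤ := fun w => (b.countN p w a (c - 1) : ℤ) - b.countN p w a c with hD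
  have hcount : (leastFactors b p).count ((a : ℂ), (c : ℂ)) =
      (Set.toFinite (b.specialWeyl p)).toFinset.sup fun w => (D w).toNat := by
    rw [leastFactors, Multiset.count_finset_sup]
    refine Finset.sup_congr rfl fun w _ => ?_
    rw [Multiset.count_sub, count_zetaDenominator w hc, count_zetaNumerator w hc, hD,
      Int.toNat_sub]
  have hone : D 1 = 0 := by
    simp only [hD, countN_one_of_pos (b := b) (p := p) a (by lia : (0 : ℤ) < (c : ℤ) - 1),
      countN_one_of_pos (b := b) (p := p) a (by lia : (0 : ℤ) < c), sub_self]
  let e : b.specialWeyl p := ⟨1, one_mem_specialWeyl⟩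
  have : Nonempty (b.specialWeyl p) := ⟨e⟩
  have hbdd : BddAbove (Set.range fun w : b.specialWeyl p => D w) := (Set.finite_range _).bddAbove
  have hnonneg : 0 ≤ ⨆ w : b.specialWeyl p, D w := hone.symm.le.trans (le_ciSup hbdd e)
  rw [hcount, countM]
  refine le_antisymm ((Int.le_toNat hnonneg).1 (Finset.sup_le fun w hw => ?_))
    (ciSup_le fun w => (D w).self_le_toNat.trans ?_)
  · exact Int.toNat_le_toNat (le_ciSup hbdd ⟨w, (Set.Finite.mem_toFinset _).1 hw⟩)
  · exact_mod_cast Finset.le_sup (f := fun w => (D w).toNat)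
      ((Set.Finite.mem_toFinset (Set.toFinite (b.specialWeyl p))).2 w.2)

theorem zetaProduct_leastFactors (Z : ℂ → ℂ) (s : ℂ) :
    zetaProduct Z (leastFactors b p) s =
      ∏ᶠ (a : ℕ) (c : ℕ) (_ : 2 ≤ c), Z (a * s + c) ^ b.countM p a c := by
  have hinj : Function.Injective (Prod.map Nat.cast Nat.cast : ℕ × ℕ → ℂ × ℂ) :=
    Nat.cast_injective.prodMap Nat.cast_injective
  have : CanLift (ℂ × ℂ) (ℕ × ℕ) (Prod.map Nat.cast Nat.cast)
    (· ∈ Set.range (Prod.map Nat.cast Nat.cast)) := ⟨fun _ => id⟩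
  obtain ⟨m, hm⟩ : ∃ m : Multiset (ℕ × ℕ), m.map (Prod.map Nat.cast Nat.cast) = leastFactors b p :=
    CanLift.prf (leastFactors b p) fun x hx =>
      let ⟨a, c, _, hac⟩ := exists_eq_natCast_of_mem_leastFactors hx
      ⟨(a, c), hac.symm⟩
  rw [← hm, zetaProduct_map_natCast]
  refine finprod_congr fun a => finprod_congr fun c => ?_
  have hcount : m.count (a, c) = (leastFactors b p).count ((a : ℂ), (c : ℂ)) := by
    rw [← hm, ← Multiset.count_map_eq_count' _ m hinj, Prod.map_apply]
  rw [finprod_eq_if, hcount]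
  split_ifs with hc
  · rw [← count_leastFactors a hc, zpow_natCast]
  · rw [Multiset.count_eq_zero_of_notMem, pow_zero]
    intro hmem
    obtain ⟨a', c', hc', hac⟩ := exists_eq_natCast_of_mem_leastFactors hmem
    have hcc' : c = c' := Nat.cast_injective (congrArg Prod.snd hac)
    exact hc (hcc' ▸ hc')

end NormalizingFactors

/-! ### Residues of periods -/

section PeriodResidue

open RootPairing RootPairing.Base

open scoped Classical

variable {ι M N : Type*} [AddCommGroup M] [Module ℂ M] [AddCommGroup N] [Module ℂ N]
  {P : RootPairing ι ℂ M N} {b : P.Base} {p : b.support} {i : ι} {w : P.weylGroup}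

/-- The coordinates `t_j`, `j ≠ p`, whose simple root `α_j` belongs to `S`: the hyperplanes
`t_j = 0` along which the factors indexed by `S` have a pole. -/
noncomputable def polarCoords (p : b.support) (S : Finset ι) : Finset b.support :=
  {j | j ≠ p ∧ (j : ι) ∈ S}

theorem mem_polarCoords {S : Finset ι} {j : b.support} :
    j ∈ polarCoords p S ↔ j ≠ p ∧ (j : ι) ∈ S := by
  simp [polarCoords]

theorem polarCoords_union (S T : Finset ι) :
    polarCoords p (S ∪ T) = polarCoords p S ∪ polarCoords p T := by
  ext j
  simp [mem_polarCoords, and_or_left]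

theorem biUnion_polarCoords_singleton (S : Finset ι) :
    (S.biUnion fun i => polarCoords p {i}) = polarCoords p S := by
  ext j
  rw [Finset.mem_biUnion, mem_polarCoords]
  constructor
  · rintro ⟨i, hi, hj⟩
    rw [mem_polarCoords, Finset.mem_singleton] at hj
    exact ⟨hj.1, hj.2 ▸ hi⟩
  · exact fun h => ⟨j, h.2, mem_polarCoords.2 ⟨h.1, Finset.mem_singleton_self _⟩⟩

theorem disjoint_polarCoords {S T : Finset ι} (h : Disjoint S T) :
    Disjoint (polarCoords p S) (polarCoords p T) :=
  Finset.disjoint_left.2 fun _ hS hT =>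
    Finset.disjoint_left.1 h (mem_polarCoords.1 hS).2 (mem_polarCoords.1 hT).2

theorem coe_mem_leviBase {j : b.support} : (j : ι) ∈ b.leviBase p ↔ j ≠ p := by
  rw [leviBase, Finset.mem_erase, and_iff_left j.2, Ne, Subtype.coe_inj]

theorem flip_height_ne_one_of_corootCoeff_eq_zero [Finite ι] [P.IsRootSystem]
    [P.IsCrystallographic] (hi : i ∉ b.leviBase p) (hcoeff : b.corootCoeff p i = 0) :
    b.flip.height i ≠ 1 := by
  intro hheight
  have hsupp : i ∈ b.support := mem_support_of_height_eq_one (b := b.flip) hheight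
  obtain rfl : i = p := by
    by_contra hip
    exact hi (Finset.mem_erase.2 ⟨hip, hsupp⟩)
  simp [corootCoeff_of_mem_support p p.2] at hcoeff

variable [Fintype ι]

/-- `w⁻¹Δ`, as a set of indices. -/
noncomputable def preimageBase (b : P.Base) (w : P.weylGroup) : Finset ι :=
  {i | P.weylGroupToPerm w i ∈ b.support}

theorem mem_preimageBase : i ∈ preimageBase b w ↔ P.weylGroupToPerm w i ∈ b.support := by
  simp [preimageBase]

theorem disjoint_preimageBase_inversionSet :
    Disjoint (preimageBase b w) (b.inversionSet w) :=
  Finset.disjoint_left.2 fun _ hi hi' =>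
    (mem_inversionSet.1 hi').2 (isPos_of_mem_support (mem_preimageBase.1 hi))

theorem polarCoords_eq_iff_mem_specialWeyl :
    polarCoords p (preimageBase b w ∪ b.inversionSet w) = polarCoords p Finset.univ ↔
      w ∈ b.specialWeyl p := by
  have hpos (j : b.support) : b.IsPos j := isPos_of_mem_support j.2
  have hlevi (j : ι) : j ∈ b.leviBase p ↔ ∃ h : j ∈ b.support, (⟨j, h⟩ : b.support) ≠ p := by
    simp [leviBase, Subtype.ext_iff, and_comm]
  simp [Finset.ext_iff, mem_polarCoords, mem_preimageBase, mem_inversionSet, specialWeyl, hlevi,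
    hpos]

variable [P.IsRootSystem]

/-- `⟨λ, α^∨⟩` as a function of the coordinates `t` of `λ = ρ + ∑ t_j λ_j`. -/
noncomputable def corootValue (b : P.Base) (i : ι) (t : b.support → ℂ) : ℂ :=
  P.toLinearMap (b.weightOfCoord t) (P.coroot i)

theorem corootValue_single (s : ℂ) :
    corootValue b i (Pi.single p s) = b.corootCoeff p i * s + b.corootHeight i := by
  rw [corootValue, toLinearMap_weightOfCoord_coroot, Fintype.sum_eq_single p fun j hj => by
    rw [Pi.single_eq_of_ne hj, zero_mul], Pi.single_eq_same, mul_comm, add_comm]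

theorem analyticAt_corootValue (i : ι) (t : b.support → ℂ) :
    AnalyticAt ℂ (corootValue b i) t := by
  have haffine : corootValue b i = fun t => b.corootHeight i + ∑ j, t j * b.corootCoeff j i :=
    funext fun t => toLinearMap_weightOfCoord_coroot t i
  rw [haffine]
  exact analyticAt_const.add (Finset.analyticAt_fun_sum _ fun j _ =>
    (analyticAt_coord t j).mul analyticAt_const)

theorem residueTerm_eq {q : ℕ} (hq : q ≠ 0) (Z : ℂ → ℂ) (s : ℂ) :
    b.residueTerm q Z p w s =
      ((Real.log q : ℂ)⁻¹ ^ (preimageBase b w ∩ b.leviBase p).card *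
        ∏ i ∈ preimageBase b w \ b.leviBase p,
          (1 - (q : ℂ) * (q : ℂ) ^ (-corootValue b i (Pi.single p s)))⁻¹) *
      ((residueAt Z 1 ^ (b.inversionSet w ∩ b.leviBase p).card *
        ∏ i ∈ b.inversionSet w \ b.leviBase p, Z (corootValue b i (Pi.single p s))) *
          (∏ i ∈ b.inversionSet w, Z (corootValue b i (Pi.single p s) + 1))⁻¹) := by
  have hcard : Finset.card {i ∈ b.leviBase p | P.weylGroupToPerm w i ∈ b.support} =
      (preimageBase b w ∩ b.leviBase p).card := by
    congr 1
    ext i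
    simp [mem_preimageBase, and_comm]
  have hsimple : (∏ i with P.weylGroupToPerm w i ∈ b.support ∧ i ∉ b.leviBase p,
      1 / (1 - (q : ℂ) ^ (-(b.corootCoeff p i * s) - b.corootHeight i + 1))) =
      ∏ i ∈ preimageBase b w \ b.leviBase p,
        (1 - (q : ℂ) * (q : ℂ) ^ (-corootValue b i (Pi.single p s)))⁻¹ := by
    refine Finset.prod_congr (by ext i; simp [mem_preimageBase]) fun i _ => ?_
    rw [add_comm, Complex.cpow_add _ _ (Nat.cast_ne_zero.2 hq), Complex.cpow_one, one_div,
      corootValue_single, neg_add']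
  have hnum : zetaProduct Z (b.zetaNumerator p w) s =
      ∏ i ∈ b.inversionSet w \ b.leviBase p, Z (corootValue b i (Pi.single p s)) := by
    simp only [zetaProduct, zetaNumerator, Multiset.map_map, corootValue_single]
    rfl
  have hden : zetaProduct Z (b.zetaDenominator p w) s =
      ∏ i ∈ b.inversionSet w, Z (corootValue b i (Pi.single p s) + 1) := by
    simp only [zetaProduct, zetaDenominator, Multiset.map_map, corootValue_single, add_assoc]
    rfl
  rw [residueTerm, hcard, hsimple, hnum, hden]
  ring

theorem HasLeadingCoeffAt.parabolicResidue_eq {F : M → ℂ} {s c : ℂ} {l : List b.support}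
    (hF : HasLeadingCoeffAt (polarCoords p Finset.univ) (fun t => F (b.weightOfCoord t))
      (Pi.single p s) c) (hl : l.Nodup) (hlp : ∀ j, j ∈ l ↔ j ≠ p) :
    b.parabolicResidue p l F s = c := by
  have hpolar : polarCoords p Finset.univ = l.toFinset := by
    ext j
    simp [mem_polarCoords, hlp]
  exact (hpolar ▸ hF).iteratedResidue_eq hl fun j hj =>
    Pi.single_eq_of_ne (M := fun _ => ℂ) ((hlp j).1 hj) s

variable [P.IsCrystallographic] [P.IsReduced]

theorem corootValue_coe (j : b.support) (t : b.support → ℂ) : corootValue b j t = 1 + t j := by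
  simp [corootValue, toLinearMap_weightOfCoord_coroot, corootHeight_of_mem_support,
    corootCoeff_of_mem_support]

theorem periodTerm_weightOfCoord {q : ℕ} (hq : q ≠ 0) (Z : ℂ → ℂ) (t : b.support → ℂ) :
    b.periodTerm q Z w (b.weightOfCoord t) =
      (∏ i ∈ preimageBase b w, (1 - (q : ℂ) * (q : ℂ) ^ (-corootValue b i t))⁻¹) *
        ((∏ i ∈ b.inversionSet w, Z (corootValue b i t)) *
          (∏ i ∈ b.inversionSet w, Z (corootValue b i t + 1))⁻¹) := by
  rw [periodTerm]
  congr 1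
  swap
  · rw [Finset.prod_div_distrib, div_eq_mul_inv]
    rfl
  symm
  refine Finset.prod_bij (fun i _ => P.weylGroupToPerm w i) ?_ ?_ (fun i hi => ?_) fun i hi => ?_
  · exact fun i hi => mem_preimageBase.1 hi
  · exact fun i _ j _ h => (P.weylGroupToPerm w).injective h
  · exact ⟨(P.weylGroupToPerm w).symm i, by simpa [mem_preimageBase] using hi, by simp⟩
  · have hheight : P.toLinearMap b.weylVector (P.coroot (P.weylGroupToPerm w i)) = 1 :=
      corootHeight_of_mem_support (mem_preimageBase.1 hi)
    rw [map_sub, LinearMap.sub_apply, toLinearMap_weylGroup_smul_coroot, hheight,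
      Equiv.symm_apply_apply, neg_sub, sub_eq_add_neg 1 (P.toLinearMap _ _),
      Complex.cpow_add _ _ (Nat.cast_ne_zero.2 hq), Complex.cpow_one, one_div, corootValue]

section Generic

variable {q : ℕ} {Z : ℂ → ℂ}

theorem eventually_one_sub_natCast_mul_cpow_corootValue_ne_zero (hq : 1 < q)
    (hi : i ∉ b.leviBase p) :
    ∀ᶠ s in Filter.codiscrete ℂ,
      1 - (q : ℂ) * (q : ℂ) ^ (-corootValue b i (Pi.single p s)) ≠ 0 := by
  simp only [corootValue_single]
  refine eventually_codiscrete_affine (eventually_one_sub_mul_cpow_neg_ne_zero hq q) _ _ fun h => ?_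
  rw [corootHeight_eq_flip_height]
  exact one_sub_natCast_mul_cpow_neg_intCast_ne_zero hq
    (flip_height_ne_one_of_corootCoeff_eq_zero hi h)

theorem IsZetaLike.eventually_corootValue (hZ : IsZetaLike Z) (hpos : b.IsPos i)
    (hi : i ∉ b.leviBase p) :
    ∀ᶠ s in Filter.codiscrete ℂ, AnalyticAt ℂ Z (corootValue b i (Pi.single p s)) := by
  simp only [corootValue_single]
  refine (hZ.eventually_affine fun h => ?_).mono fun _ => And.left
  have hheight : 1 < b.flip.height i :=
    lt_of_le_of_ne (isPos_iff_flip_height_pos.1 hpos)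
      (flip_height_ne_one_of_corootCoeff_eq_zero hi h).symm
  rw [corootHeight_eq_flip_height, Complex.intCast_re]
  exact_mod_cast hheight

theorem IsZetaLike.eventually_corootValue_add_one (hZ : IsZetaLike Z) (hpos : b.IsPos i) :
    ∀ᶠ s in Filter.codiscrete ℂ, AnalyticAt ℂ Z (corootValue b i (Pi.single p s) + 1) ∧
      Z (corootValue b i (Pi.single p s) + 1) ≠ 0 := by
  simp only [corootValue_single, add_assoc]
  refine hZ.eventually_affine fun _ => ?_
  have hheight : 0 < b.flip.height i := isPos_iff_flip_height_pos.1 hpos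
  rw [corootHeight_eq_flip_height, Complex.add_re, Complex.intCast_re, Complex.one_re]
  exact lt_add_of_pos_left 1 (by exact_mod_cast hheight)

end Generic

theorem HasSimplePoleAt.hasLeadingCoeffAt_corootValue {f : ℂ → ℂ} {r s : ℂ}
    (hf : HasSimplePoleAt f 1 r)
    (hfi : i ∉ b.leviBase p → AnalyticAt ℂ f (corootValue b i (Pi.single p s))) :
    HasLeadingCoeffAt (polarCoords p {i}) (fun t => f (corootValue b i t)) (Pi.single p s)
      (if i ∈ b.leviBase p then r else f (corootValue b i (Pi.single p s))) := by
  split_ifs with hi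
  · lift i to b.support using Finset.mem_of_mem_erase hi
    have hip : i ≠ p := coe_mem_leviBase.1 hi
    have hpolar : polarCoords p {(i : ι)} = {i} := by
      ext j
      simp only [mem_polarCoords, Finset.mem_singleton, SetLike.coe_eq_coe, and_iff_right_iff_imp]
      exact fun h => h ▸ hip
    simp only [hpolar, corootValue_coe]
    exact hf.hasLeadingCoeffAt (Pi.single_eq_of_ne (M := fun _ => ℂ) hip s)
  · have hpolar : polarCoords p {i} = ∅ := Finset.eq_empty_of_forall_notMem fun j hj => by
      rw [mem_polarCoords, Finset.mem_singleton, ← coe_mem_leviBase] at hj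
      exact hi (hj.2 ▸ hj.1)
    rw [hpolar]
    exact hasLeadingCoeffAt_of_analyticAt ((hfi hi).comp (analyticAt_corootValue i _))

theorem HasSimplePoleAt.hasLeadingCoeffAt_prod_corootValue {f : ℂ → ℂ} {r s : ℂ} {S : Finset ι}
    (hf : HasSimplePoleAt f 1 r)
    (hfS : ∀ i ∈ S, i ∉ b.leviBase p → AnalyticAt ℂ f (corootValue b i (Pi.single p s))) :
    HasLeadingCoeffAt (polarCoords p S) (fun t => ∏ i ∈ S, f (corootValue b i t)) (Pi.single p s)
      (r ^ (S ∩ b.leviBase p).card *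
        ∏ i ∈ S \ b.leviBase p, f (corootValue b i (Pi.single p s))) := by
  have hcoeff : r ^ (S ∩ b.leviBase p).card *
      ∏ i ∈ S \ b.leviBase p, f (corootValue b i (Pi.single p s)) =
        ∏ i ∈ S, if i ∈ b.leviBase p then r else f (corootValue b i (Pi.single p s)) := by
    rw [Finset.prod_ite, Finset.filter_mem_eq_inter, Finset.filter_notMem_eq_sdiff,
      Finset.prod_const]
  rw [hcoeff, ← biUnion_polarCoords_singleton]
  exact HasLeadingCoeffAt.prod (fun i hi => hf.hasLeadingCoeffAt_corootValue (hfS i hi))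
    fun i _ j _ hij => disjoint_polarCoords (Finset.disjoint_singleton.2 hij)

variable {q : ℕ} {Z : ℂ → ℂ}

theorem eventually_hasLeadingCoeffAt_polarCoords (hq : 1 < q) (hZ : IsZetaLike Z)
    (p : b.support) (w : P.weylGroup) :
    ∀ᶠ s in Filter.codiscrete ℂ,
      HasLeadingCoeffAt (polarCoords p (preimageBase b w ∪ b.inversionSet w))
        (fun t => b.periodTerm q Z w (b.weightOfCoord t)) (Pi.single p s)
        (b.residueTerm q Z p w s) := by
  have hq₀ : q ≠ 0 := by lia
  have hpos {i : ι} (hi : i ∈ b.inversionSet w) : b.IsPos i := (mem_inversionSet.1 hi).1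
  have hlog : HasSimplePoleAt (fun z => (1 - (q : ℂ) * (q : ℂ) ^ (-z))⁻¹) 1 (Real.log q : ℂ)⁻¹ :=
    hasSimplePoleAt_inv_one_sub_mul_cpow_neg hq (by
      rw [Complex.cpow_neg_one, mul_inv_cancel₀ (Nat.cast_ne_zero.2 hq₀)])
  have hsimple : ∀ᶠ s in Filter.codiscrete ℂ, ∀ i ∉ b.leviBase p,
      1 - (q : ℂ) * (q : ℂ) ^ (-corootValue b i (Pi.single p s)) ≠ 0 :=
    Filter.eventually_all.2 fun _ => Filter.eventually_imp_distrib_left.2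
      (eventually_one_sub_natCast_mul_cpow_corootValue_ne_zero hq)
  have hnum : ∀ᶠ s in Filter.codiscrete ℂ, ∀ i ∈ b.inversionSet w, i ∉ b.leviBase p →
      AnalyticAt ℂ Z (corootValue b i (Pi.single p s)) :=
    (Finset.eventually_all _).2 fun _ hi => Filter.eventually_imp_distrib_left.2
      (hZ.eventually_corootValue (hpos hi))
  have hden : ∀ᶠ s in Filter.codiscrete ℂ, ∀ i ∈ b.inversionSet w,
      AnalyticAt ℂ Z (corootValue b i (Pi.single p s) + 1) ∧
        Z (corootValue b i (Pi.single p s) + 1) ≠ 0 :=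
    (Finset.eventually_all _).2 fun _ hi => hZ.eventually_corootValue_add_one (hpos hi)
  filter_upwards [hsimple, hnum, hden] with s hsimple hnum hden
  have hdenAt : AnalyticAt ℂ (fun t => (∏ i ∈ b.inversionSet w, Z (corootValue b i t + 1))⁻¹)
      (Pi.single p s) :=
    (Finset.analyticAt_fun_prod _ fun i hi => AnalyticAt.fun_comp (g := Z)
      (f := fun t => corootValue b i t + 1) (hden i hi).1
      ((analyticAt_corootValue i _).add analyticAt_const)).fun_inv
      (Finset.prod_ne_zero_iff.2 fun i hi => (hden i hi).2)
  simp only [residueTerm_eq hq₀, periodTerm_weightOfCoord hq₀, polarCoords_union]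
  refine (hlog.hasLeadingCoeffAt_prod_corootValue fun i _ hi => ?_).mul ?_
    (disjoint_polarCoords disjoint_preimageBase_inversionSet)
  · exact (analyticAt_one_sub_mul_cpow_neg hq₀ q _).inv (hsimple i hi)
  · simpa using (hZ.hasSimplePoleAt_one.hasLeadingCoeffAt_prod_corootValue hnum).mul
      (hasLeadingCoeffAt_of_analyticAt hdenAt) (Finset.disjoint_empty_right _)

theorem eventually_hasLeadingCoeffAt_periodTerm (hq : 1 < q) (hZ : IsZetaLike Z)
    (p : b.support) (w : P.weylGroup) :
    ∀ᶠ s in Filter.codiscrete ℂ, HasLeadingCoeffAt (polarCoords p Finset.univ)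
      (fun t => b.periodTerm q Z w (b.weightOfCoord t)) (Pi.single p s)
      (if w ∈ b.specialWeyl p then b.residueTerm q Z p w s else 0) := by
  filter_upwards [eventually_hasLeadingCoeffAt_polarCoords hq hZ p w] with s hs
  split_ifs with hw
  · rwa [← polarCoords_eq_iff_mem_specialWeyl.2 hw]
  · refine hs.zero_of_ssubset (ssubset_of_subset_of_ne (fun j hj => ?_)
      (mt polarCoords_eq_iff_mem_specialWeyl.1 hw)) fun j hj => ?_
    · exact mem_polarCoords.2 ⟨(mem_polarCoords.1 hj).1, Finset.mem_univ _⟩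
    · exact Pi.single_eq_of_ne (M := fun _ => ℂ) (mem_polarCoords.1 hj).1 s

theorem parabolicResidue_periodTerm (hq : 1 < q) (hZ : IsZetaLike Z) {l : List b.support}
    (hl : l.Nodup) (hlp : ∀ j, j ∈ l ↔ j ≠ p) (w : P.weylGroup) :
    b.parabolicResidue p l (b.periodTerm q Z w) =ᶠ[Filter.codiscrete ℂ]
      fun s => if w ∈ b.specialWeyl p then b.residueTerm q Z p w s else 0 :=
  (eventually_hasLeadingCoeffAt_periodTerm hq hZ p w).mono fun _ hs => hs.parabolicResidue_eq hl hlp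

theorem parabolicPeriod_eventuallyEq (hq : 1 < q) (hZ : IsZetaLike Z) {l : List b.support}
    (hl : l.Nodup) (hlp : ∀ j, j ∈ l ↔ j ≠ p) :
    b.parabolicPeriod q Z p l =ᶠ[Filter.codiscrete ℂ]
      fun s => ∑ᶠ w ∈ b.specialWeyl p, b.residueTerm q Z p w s := by
  have := Fintype.ofFinite P.weylGroup
  filter_upwards [Filter.eventually_all.2 (eventually_hasLeadingCoeffAt_periodTerm hq hZ p)]
    with s hs
  have hperiod : b.period q Z = fun x => ∑ w, b.periodTerm q Z w x :=
    funext fun _ => finsum_eq_sum_of_fintype _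
  simp only [parabolicPeriod, hperiod, finsum_eq_sum_of_fintype, finsum_eq_if]
  exact (HasLeadingCoeffAt.sum fun w _ => hs w).parabolicResidue_eq hl hlp

end PeriodResidue

/-! ### Counting points of curves -/

section PowerSum

open Finset

variable {ι R : Type*}

theorem exists_eval_eq_one_and_eval_eq_zero [Finite ι] [Field R] (x : ι → R) (i : ι) :
    ∃ f : R[X], f.eval (x i) = 1 ∧ ∀ j, x j ≠ x i → f.eval (x j) = 0 := by
  classical
  have := Fintype.ofFinite ι
  exact ⟨Lagrange.basis (univ.image x) id (x i),
    Lagrange.eval_basis_self Function.injective_id.injOn (mem_image_of_mem x (mem_univ i)),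
    fun j hj => Lagrange.eval_basis_of_ne (v := id) hj.symm (mem_image_of_mem x (mem_univ j))⟩

variable [Fintype ι]

theorem sum_pow_mul_eval_eq [CommSemiring R] (x : ι → R) (f : R[X]) (m : ℕ) :
    ∑ j, x j ^ m * f.eval (x j) =
      ∑ n ∈ range (f.natDegree + 1), f.coeff n * ∑ j, x j ^ (m + n) := by
  simp_rw [Polynomial.eval_eq_sum_range, mul_sum]
  rw [sum_comm]
  exact sum_congr rfl fun n _ => sum_congr rfl fun j _ => by rw [pow_add, mul_left_comm]

theorem exists_forall_norm_pow_le_of_norm_sum_pow_le [NormedField R] [CharZero R] {x : ι → R}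
    {C q : ℝ} (h : ∀ m, 1 ≤ m → ‖∑ j, x j ^ m‖ ≤ C * q ^ m) (i : ι) :
    ∃ D, ∀ m, 1 ≤ m → ‖x i‖ ^ m ≤ D * q ^ m := by
  classical
  obtain ⟨f, hfi, hf⟩ := exists_eval_eq_one_and_eval_eq_zero x i
  set c : R := ((univ.filter fun j => x j = x i).card : R)
  have hc : 0 < ‖c‖ := norm_pos_iff.2 (Nat.cast_ne_zero.2 (card_ne_zero.2 ⟨i, by simp⟩))
  have hsum (m : ℕ) : c * x i ^ m =
      ∑ n ∈ range (f.natDegree + 1), f.coeff n * ∑ j, x j ^ (m + n) := by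
    have hterm (j : ι) : x j ^ m * f.eval (x j) = if x j = x i then x i ^ m else 0 := by
      split_ifs with hj
      · rw [hj, hfi, mul_one]
      · rw [hf j hj, mul_zero]
    rw [← sum_pow_mul_eval_eq, sum_congr rfl fun j _ => hterm j, ← sum_filter, sum_const,
      nsmul_eq_mul]
  refine ⟨(∑ n ∈ range (f.natDegree + 1), ‖f.coeff n‖ * (C * q ^ n)) / ‖c‖, fun m hm => ?_⟩
  rw [div_mul_eq_mul_div, le_div_iff₀' hc, ← norm_pow, ← norm_mul, hsum, sum_mul]
  refine (norm_sum_le _ _).trans (sum_le_sum fun n _ => ?_)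
  calc ‖f.coeff n * ∑ j, x j ^ (m + n)‖ ≤ ‖f.coeff n‖ * (C * q ^ (m + n)) := by
        rw [norm_mul]
        exact mul_le_mul_of_nonneg_left (h _ (by lia)) (norm_nonneg _)
    _ = ‖f.coeff n‖ * (C * q ^ n) * q ^ m := by ring

theorem le_of_forall_pow_le_mul_pow {r q D : ℝ} (hq : 0 < q)
    (h : ∀ m, 1 ≤ m → r ^ m ≤ D * q ^ m) : r ≤ q := by
  by_contra! hlt
  obtain ⟨m, hm⟩ := ((tendsto_pow_atTop_atTop_of_one_lt ((one_lt_div hq).2 hlt)).eventually_gt_atTop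
    D |>.and (Filter.eventually_ge_atTop 1)).exists
  rw [div_pow, lt_div_iff₀ (pow_pos hq m)] at hm
  exact (h m hm.2).not_gt hm.1

theorem norm_le_of_norm_sum_pow_le [NormedField R] [CharZero R] {x : ι → R} {C q : ℝ}
    (hq : 0 < q) (h : ∀ m, 1 ≤ m → ‖∑ j, x j ^ m‖ ≤ C * q ^ m) (i : ι) : ‖x i‖ ≤ q :=
  (exists_forall_norm_pow_le_of_norm_sum_pow_le h i).elim fun _ => le_of_forall_pow_le_mul_pow hq

end PowerSum

section AlgHomCount

theorem ringKrullDim_le_of_hasGoingUp {R S : Type*} [CommRing R] [CommRing S] [Algebra R S]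
    [Algebra.HasGoingUp R S]
    (hsurj : Function.Surjective (PrimeSpectrum.comap (algebraMap R S))) :
    ringKrullDim R ≤ ringKrullDim S := by
  refine iSup_le fun c => ?_
  obtain ⟨Q, hQ⟩ := hsurj c.head
  have : Q.asIdeal.LiesOver c.head.asIdeal := ⟨congrArg PrimeSpectrum.asIdeal hQ.symm⟩
  obtain ⟨L, hL, -⟩ := Ideal.exists_ltSeries_of_hasGoingUp c Q.asIdeal
  exact hL ▸ le_iSup (fun L : LTSeries (PrimeSpectrum S) => (L.length : WithBot ℕ∞)) L

theorem finite_and_card_algHom_le_ncard {R A : Type*} [CommSemiring R] [Semiring A] [Algebra R A]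
    {s : Set A} (hs : s.Finite) (hspan : Submodule.span R s = ⊤)
    (K : Type*) [Field K] [Algebra R K] :
    Finite (A →ₐ[R] K) ∧ Nat.card (A →ₐ[R] K) ≤ s.ncard := by
  have := hs.fintype
  let restrict : (A →ₗ[R] K) →ₗ[K] s → K :=
    { toFun := fun φ a => φ a
      map_add' := fun _ _ => rfl
      map_smul' := fun _ _ => rfl }
  have hker : restrict.ker = ⊥ := LinearMap.ker_eq_bot.2 fun φ ψ h =>
    LinearMap.ext_on hspan fun a ha => congrFun h ⟨a, ha⟩
  have hindep := (linearIndependent_algHom_toLinearMap R A K).map' restrict hker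
  have hfinite := hindep.finite
  have := Fintype.ofFinite (A →ₐ[R] K)
  refine ⟨hfinite, ?_⟩
  rw [Nat.card_eq_fintype_card, ← Nat.card_coe_set_eq, Nat.card_eq_fintype_card]
  exact hindep.fintype_card_le_finrank.trans_eq (Module.finrank_fintype_fun_eq_card K)

theorem finite_and_card_algHom_le_card_mul {R S A K : Type*} [CommSemiring R] [CommSemiring S]
    [CommSemiring A] [CommSemiring K] [Algebra R S] [Algebra R A] [Algebra S A]
    [IsScalarTower R S A] [Algebra R K] [Finite (S →ₐ[R] K)] {C : ℕ}
    (hC : ∀ [Algebra S K], Finite (A →ₐ[S] K) ∧ Nat.card (A →ₐ[S] K) ≤ C) :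
    Finite (A →ₐ[R] K) ∧ Nat.card (A →ₐ[R] K) ≤ Nat.card (S →ₐ[R] K) * C := by
  have := Fintype.ofFinite (S →ₐ[R] K)
  have hfiber (φ : S →ₐ[R] K) : Finite (@AlgHom S A K _ _ _ _ φ.toRingHom.toAlgebra) :=
    (@hC φ.toRingHom.toAlgebra).1
  refine ⟨Finite.of_equiv _ (algHomEquivSigma (B := S)).symm, ?_⟩
  rw [Nat.card_congr (algHomEquivSigma (B := S)), Nat.card_sigma, Nat.card_eq_fintype_card,
    ← smul_eq_mul, ← Finset.card_univ]
  exact Finset.sum_le_card_nsmul _ _ _ fun φ _ => (@hC φ.toRingHom.toAlgebra).2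

/-- The `K`-valued points of the affine space of dimension `σ` over `k`, identified with their
coordinates. -/
noncomputable def mvPolynomialAlgHomEquiv (k σ K : Type*) [CommSemiring k] [CommSemiring K]
    [Algebra k K] : (MvPolynomial σ k →ₐ[k] K) ≃ (σ → K) where
  toFun φ i := φ (.X i)
  invFun := MvPolynomial.aeval
  left_inv φ := by ext; simp
  right_inv x := by ext; simp

theorem exists_finite_and_card_algHom_le (k A : Type*) [Field k] [CommRing A] [Algebra k A]
    [Algebra.FiniteType k A] {d : ℕ} (hd : ringKrullDim A ≤ d) :
    ∃ C : ℕ, ∀ (K : Type u) [Field K] [Algebra k K] [Finite K],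
      Finite (A →ₐ[k] K) ∧ Nat.card (A →ₐ[k] K) ≤ C * Nat.card K ^ d := by
  rcases subsingleton_or_nontrivial A with hA | hA
  · refine ⟨0, fun K _ _ _ => ?_⟩
    have : IsEmpty (A →ₐ[k] K) :=
      ⟨fun φ => not_nontrivial_iff_subsingleton.2 hA φ.toRingHom.domain_nontrivial⟩
    exact ⟨inferInstance, by simp⟩
  obtain ⟨n, g, hg, hfin⟩ := exists_finite_inj_algHom_of_fg k A
  algebraize [g.toRingHom]
  have : IsScalarTower k (MvPolynomial (Fin n) k) A := .of_algHom g
  have : FaithfulSMul (MvPolynomial (Fin n) k) A := (faithfulSMul_iff_algebraMap_injective _ _).2 hg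
  have : Module.Finite (MvPolynomial (Fin n) k) A := hfin
  have hnd : n ≤ d := by
    have hdim := (ringKrullDim_le_of_hasGoingUp
      (Algebra.IsIntegral.comap_surjective (MvPolynomial (Fin n) k) A)).trans hd
    rw [MvPolynomial.ringKrullDim_of_isNoetherianRing, ringKrullDim_eq_zero_of_field, zero_add,
      Nat.card_fin] at hdim
    exact_mod_cast hdim
  obtain ⟨G, hG⟩ := Module.Finite.fg_top (R := MvPolynomial (Fin n) k) (M := A)
  refine ⟨G.card, fun K _ _ _ => ?_⟩
  have hcard : Nat.card (MvPolynomial (Fin n) k →ₐ[k] K) = Nat.card K ^ n := by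
    rw [Nat.card_congr (mvPolynomialAlgHomEquiv k (Fin n) K), Nat.card_fun, Nat.card_fin]
  have : Finite (MvPolynomial (Fin n) k →ₐ[k] K) :=
    .of_equiv _ (mvPolynomialAlgHomEquiv k (Fin n) K).symm
  obtain ⟨hfinite, hle⟩ := finite_and_card_algHom_le_card_mul (R := k)
    (finite_and_card_algHom_le_ncard G.finite_toSet hG K)
  refine ⟨hfinite, hle.trans ?_⟩
  rw [hcard, Set.ncard_coe_finset, mul_comm]
  exact Nat.mul_le_mul_left _ (Nat.pow_le_pow_right Nat.card_pos hnd)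

end AlgHomCount

section PointsOfSchemes

variable {k : Type u} [Field k]

/-- The points of a scheme `f : X ⟶ Spec k` with values in a field extension `K` of `k`. -/
def PointsOver {X : Scheme.{u}} (f : X ⟶ Spec (.of k)) (K : Type u) [Field K] [Algebra k K] :
    Type u :=
  {x : Spec (.of K) ⟶ X // x ≫ f = Spec.map (CommRingCat.ofHom (algebraMap k K))}

/-- The `K`-valued points of an affine `k`-scheme are the `k`-algebra homomorphisms from its
coordinate ring to `K`. -/
noncomputable def pointsOverSpecEquiv (R : Type u) [CommRing R] [Algebra k R]
    (K : Type u) [Field K] [Algebra k K] :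
    PointsOver (Spec.map (CommRingCat.ofHom (algebraMap k R))) K ≃ (R →ₐ[k] K) where
  toFun x := AlgHom.mk (Spec.preimage x.1).hom fun a => by
    have h : CommRingCat.ofHom (algebraMap k R) ≫ Spec.preimage x.1 =
        CommRingCat.ofHom (algebraMap k K) :=
      Spec.map_injective (by rw [Spec.map_comp, Spec.map_preimage, x.2])
    exact congr($(h).hom a)
  invFun φ := ⟨Spec.map (CommRingCat.ofHom φ.toRingHom), by
    rw [← Spec.map_comp, ← CommRingCat.ofHom_comp, AlgHom.toRingHom_eq_coe, φ.comp_algebraMap]⟩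
  left_inv x := Subtype.ext (Spec.map_preimage x.1)
  right_inv φ := by ext a; exact congr($(Spec.preimage_map (CommRingCat.ofHom φ.toRingHom)).hom a)

theorem exists_finite_and_card_pointsOver_le_of_isAffine {X : Scheme.{u}} [IsAffine X]
    (f : X ⟶ Spec (.of k)) [LocallyOfFiniteType f] {d : ℕ} (hd : topologicalKrullDim X ≤ d) :
    ∃ C : ℕ, ∀ (K : Type u) [Field K] [Algebra k K] [Finite K],
      Finite (PointsOver f K) ∧ Nat.card (PointsOver f K) ≤ C * Nat.card K ^ d := by
  obtain ⟨φ, hφ⟩ := Spec.map_surjective (X.isoSpec.inv ≫ f)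
  algebraize [φ.hom]
  have hft : LocallyOfFiniteType (Spec.map φ) := hφ ▸ inferInstance
  have : Algebra.FiniteType k Γ(X, ⊤) :=
    (HasRingHomProperty.Spec_iff (P := @LocallyOfFiniteType)).1 hft
  have hdim : ringKrullDim Γ(X, ⊤) ≤ d :=
    PrimeSpectrum.topologicalKrullDim_eq_ringKrullDim Γ(X, ⊤) ▸
      X.isoSpec.inv.isOpenEmbedding.isInducing.topologicalKrullDim_le.trans hd
  obtain ⟨C, hC⟩ := exists_finite_and_card_algHom_le k Γ(X, ⊤) hdim
  refine ⟨C, fun K _ _ _ => ?_⟩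
  have hmem (x : PointsOver f K) : (x.1 ≫ X.isoSpec.hom) ≫ Spec.map φ =
      Spec.map (CommRingCat.ofHom (algebraMap k K)) := by
    rw [hφ, Category.assoc, Iso.hom_inv_id_assoc, x.2]
  have hinj : Function.Injective fun x : PointsOver f K =>
      pointsOverSpecEquiv Γ(X, ⊤) K ⟨x.1 ≫ X.isoSpec.hom, hmem x⟩ := fun x y h =>
    Subtype.ext <| (cancel_mono X.isoSpec.hom).1 <|
      congrArg Subtype.val ((pointsOverSpecEquiv Γ(X, ⊤) K).injective h)
  obtain ⟨hfinite, hcard⟩ := hC K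
  exact ⟨.of_injective _ hinj, (Nat.card_le_card_of_injective _ hinj).trans hcard⟩

theorem exists_pointsOver_comp_eq {X : Scheme.{u}} (f : X ⟶ Spec (.of k)) (𝒰 : X.OpenCover)
    {K : Type u} [Field K] [Algebra k K] (x : PointsOver f K) :
    ∃ (i : 𝒰.I₀) (y : PointsOver (𝒰.f i ≫ f) K), y.1 ≫ 𝒰.f i = x.1 := by
  have : Subsingleton (Spec (.of K)) := inferInstanceAs (Subsingleton (PrimeSpectrum K))
  obtain ⟨i, y, hy⟩ := 𝒰.exists_eq (x.1 (default : PrimeSpectrum K))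
  have hrange : Set.range x.1 ⊆ Set.range (𝒰.f i) := by
    rintro _ ⟨z, rfl⟩
    exact ⟨y, hy.trans (congrArg x.1 (Subsingleton.elim _ z))⟩
  exact ⟨i, ⟨IsOpenImmersion.lift (𝒰.f i) x.1 hrange,
    by rw [IsOpenImmersion.lift_fac_assoc, x.2]⟩, IsOpenImmersion.lift_fac _ _ _⟩

theorem card_pointsOver_le_sum {X : Scheme.{u}} (f : X ⟶ Spec (.of k)) (𝒰 : X.OpenCover)
    [Fintype 𝒰.I₀] (K : Type u) [Field K] [Algebra k K]
    [∀ i, Finite (PointsOver (𝒰.f i ≫ f) K)] :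
    Nat.card (PointsOver f K) ≤ ∑ i, Nat.card (PointsOver (𝒰.f i ≫ f) K) := by
  choose i y hy using exists_pointsOver_comp_eq (K := K) f 𝒰
  have hinj : Function.Injective fun x => (⟨i x, y x⟩ : Σ i, PointsOver (𝒰.f i ≫ f) K) := by
    intro x x' h
    refine Subtype.ext ((hy x).symm.trans (.trans ?_ (hy x')))
    exact congrArg (fun z : Σ i, PointsOver (𝒰.f i ≫ f) K => z.2.1 ≫ 𝒰.f z.1) h
  exact (Nat.card_le_card_of_injective _ hinj).trans_eq Nat.card_sigma

theorem exists_card_pointsOver_le {X : Scheme.{u}} [CompactSpace X] (f : X ⟶ Spec (.of k))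
    [LocallyOfFiniteType f] {d : ℕ} (hd : topologicalKrullDim X ≤ d) :
    ∃ C : ℕ, ∀ (K : Type u) [Field K] [Algebra k K] [Finite K],
      Nat.card (PointsOver f K) ≤ C * Nat.card K ^ d := by
  let 𝒰 := X.affineCover.finiteSubcover
  have hdim (i : 𝒰.I₀) : topologicalKrullDim (𝒰.X i) ≤ d :=
    (𝒰.f i).isOpenEmbedding.isInducing.topologicalKrullDim_le.trans hd
  choose C hC using fun i : 𝒰.I₀ =>
    exists_finite_and_card_pointsOver_le_of_isAffine (𝒰.f i ≫ f) (hdim i)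
  refine ⟨∑ i, C i, fun K _ _ _ => ?_⟩
  have (i : 𝒰.I₀) : Finite (PointsOver (𝒰.f i ≫ f) K) := (hC i K).1
  calc Nat.card (PointsOver f K) ≤ ∑ i, Nat.card (PointsOver (𝒰.f i ≫ f) K) :=
        card_pointsOver_le_sum f 𝒰 K
    _ ≤ ∑ i, C i * Nat.card K ^ d := Finset.sum_le_sum fun i _ => (hC i K).2
    _ = (∑ i, C i) * Nat.card K ^ d := (Finset.sum_mul ..).symm

end PointsOfSchemes

section Curve

theorem finite_and_card_splittingField_X_pow_sub_X (k : Type*) [Field k] [Finite k] {n : ℕ}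
    (hn : n ≠ 0) :
    Finite (Polynomial.X ^ Nat.card k ^ n - Polynomial.X : k[X]).SplittingField ∧
      Nat.card (Polynomial.X ^ Nat.card k ^ n - Polynomial.X : k[X]).SplittingField =
        Nat.card k ^ n := by
  have : NeZero n := ⟨hn⟩
  have : Fact (ringChar k).Prime := ⟨CharP.char_is_prime k _⟩
  let e := Polynomial.IsSplittingField.algEquiv (FiniteField.Extension k (ringChar k) n)
    (Polynomial.X ^ Nat.card k ^ n - Polynomial.X : k[X])
  exact ⟨.of_equiv _ e.toEquiv, (Nat.card_congr e.symm.toEquiv).trans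
    (FiniteField.natCard_extension k (ringChar k) n)⟩

attribute [local instance] MvPolynomial.gradedAlgebra

theorem algebraMap_homogeneousSubmodule_zero_surjective (σ R : Type*) [CommRing R] :
    Function.Surjective (algebraMap R (MvPolynomial.homogeneousSubmodule σ R 0)) := by
  rintro ⟨x, hx⟩
  have hdeg : x.totalDegree = 0 := Nat.le_zero.1 (MvPolynomial.IsHomogeneous.totalDegree_le hx)
  exact ⟨x.coeff 0, Subtype.ext (MvPolynomial.totalDegree_eq_zero_iff_eq_C.1 hdeg).symm⟩

instance finiteType_homogeneousSubmodule_zero (σ R : Type*) [Finite σ] [CommRing R] :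
    Algebra.FiniteType (MvPolynomial.homogeneousSubmodule σ R 0) (MvPolynomial σ R) :=
  have : IsScalarTower R (MvPolynomial.homogeneousSubmodule σ R 0) (MvPolynomial σ R) :=
    ⟨fun r a x => smul_mul_assoc r a.1 x⟩
  .of_restrictScalars_finiteType R _ _

instance locallyOfFiniteType_projectiveSpaceHom (k : Type u) [Field k] (n : ℕ) :
    LocallyOfFiniteType (projectiveSpaceHom k n) := by
  have : LocallyOfFiniteType (Spec.map (CommRingCat.ofHom
      (algebraMap k (MvPolynomial.homogeneousSubmodule (Fin (n + 1)) k 0)))) :=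
    (HasRingHomProperty.Spec_iff (P := @LocallyOfFiniteType)).2 <|
      RingHom.FiniteType.of_surjective _ (algebraMap_homogeneousSubmodule_zero_surjective _ k)
  unfold projectiveSpaceHom
  infer_instance

instance quasiCompact_projectiveSpaceHom (k : Type u) [Field k] (n : ℕ) :
    QuasiCompact (projectiveSpaceHom k n) := by
  unfold projectiveSpaceHom
  infer_instance

namespace IsRegularProjectiveCurve

variable {k : Type u} [Field k] {X : Scheme.{u}} {f : X ⟶ Spec (.of k)}

theorem locallyOfFiniteType (hX : IsRegularProjectiveCurve f) : LocallyOfFiniteType f := by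
  obtain ⟨n, i, hi, rfl⟩ := hX.projective
  infer_instance

theorem compactSpace (hX : IsRegularProjectiveCurve f) : CompactSpace X := by
  obtain ⟨n, i, hi, rfl⟩ := hX.projective
  exact QuasiCompact.compactSpace_of_compactSpace (i ≫ projectiveSpaceHom k n)

theorem exists_pointCount_le [Finite k] (hX : IsRegularProjectiveCurve f) :
    ∃ C : ℕ, ∀ n : ℕ, n ≠ 0 → pointCount f n ≤ C * Nat.card k ^ n := by
  have := hX.locallyOfFiniteType
  have := hX.compactSpace
  obtain ⟨C, hC⟩ := exists_card_pointsOver_le f (d := 1) hX.dim_eq_one.le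
  refine ⟨C, fun n hn => ?_⟩
  obtain ⟨hfinite, hcard⟩ := finite_and_card_splittingField_X_pow_sub_X k hn
  exact (hC _).trans_eq (by rw [hcard, pow_one])

theorem norm_frobeniusEigenvalues_le [Finite k] (hX : IsRegularProjectiveCurve f)
    (i : Fin (2 * curveGenus f)) : ‖frobeniusEigenvalues f i‖ ≤ Nat.card k := by
  have hq : (1 : ℝ) < Nat.card k := by exact_mod_cast Finite.one_lt_card
  rw [frobeniusEigenvalues]
  split_ifs with h
  · obtain ⟨C, hC⟩ := hX.exists_pointCount_le
    refine norm_le_of_norm_sum_pow_le (C := C + 2) (by linarith) (fun m hm => ?_) i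
    have hsum : ∑ j, h.choose j ^ m = (Nat.card k : ℂ) ^ m + 1 - pointCount f m := by
      rw [h.choose_spec m hm]
      ring
    have hcount : (pointCount f m : ℝ) ≤ C * (Nat.card k : ℝ) ^ m := by
      exact_mod_cast hC m (Nat.one_le_iff_ne_zero.1 hm)
    calc ‖∑ j, h.choose j ^ m‖ ≤ (Nat.card k : ℝ) ^ m + 1 + pointCount f m := by
          rw [hsum]
          refine (norm_sub_le _ _).trans (add_le_add ((norm_add_le _ _).trans ?_) ?_) <;> simp
      _ ≤ (C + 2) * (Nat.card k : ℝ) ^ m := by linarith [one_le_pow₀ hq.le (n := m)]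
  · simp

theorem isZetaLike_completeZeta [Finite k] (hX : IsRegularProjectiveCurve f) :
    IsZetaLike (completeZeta f) :=
  isZetaLike_weilZeta Finite.one_lt_card hX.norm_frobeniusEigenvalues_le

end IsRegularProjectiveCurve

end Curve

theorem theorem6_general {q : ℕ} (hq : 1 < q) {Z : ℂ → ℂ} (hZ : IsZetaLike Z)
    {ι M N : Type*} [Fintype ι] [AddCommGroup M] [Module ℂ M] [AddCommGroup N] [Module ℂ N]
    (P : RootPairing ι ℂ M N) [P.IsRootSystem] [P.IsCrystallographic] [P.IsReduced]
    (b : P.Base) (p : b.support)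
    (l : List b.support) (hl : l.Nodup) (hlp : ∀ j, j ∈ l ↔ j ≠ p) :
    ((∀ w ∉ b.specialWeyl p,
        b.parabolicResidue p l (b.periodTerm (q) (Z) w)
          =ᶠ[Filter.codiscrete ℂ] fun _ => 0) ∧
      (∀ w ∈ b.specialWeyl p,
        b.parabolicResidue p l (b.periodTerm (q) (Z) w)
          =ᶠ[Filter.codiscrete ℂ] b.residueTerm (q) (Z) p w) ∧
      b.parabolicPeriod (q) (Z) p l
        =ᶠ[Filter.codiscrete ℂ]
          fun s => ∑ᶠ w ∈ b.specialWeyl p, b.residueTerm (q) (Z) p w s) ∧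
    (∃! m, b.IsMinimalNormalization p m) ∧
    (∀ a c : ℕ, 2 ≤ c →
      ((b.minimalFactors p).count ((a : ℂ), (c : ℂ)) : ℤ) = b.countM p a c) ∧
    (∀ x ∈ b.minimalFactors p, ∃ a c : ℕ, 2 ≤ c ∧ x = ((a : ℂ), (c : ℂ))) ∧
    (∀ s : ℂ, b.groupZeta (q) (Z) p l s =
      b.parabolicPeriod (q) (Z) p l s *
        ∏ᶠ (a : ℕ) (c : ℕ) (_ : 2 ≤ c), Z (a * s + c) ^ b.countM p a c) := by
  refine ⟨⟨fun w hw => ?_, fun w hw => ?_, parabolicPeriod_eventuallyEq hq hZ hl hlp⟩,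
    existsUnique_isMinimalNormalization, fun a c hc => ?_, fun x hx => ?_, fun s => ?_⟩
  · simpa [hw] using parabolicResidue_periodTerm hq hZ hl hlp w
  · simpa [hw] using parabolicResidue_periodTerm hq hZ hl hlp w
  · rw [minimalFactors_eq_leastFactors, count_leastFactors a hc]
  · exact exists_eq_natCast_of_mem_leastFactors (minimalFactors_eq_leastFactors (b := b) ▸ hx)
  · rw [RootPairing.Base.groupZeta, minimalFactors_eq_leastFactors, zetaProduct_leastFactors,
      mul_comm]

theorem theorem6 {k : Type u} [Field k] [Finite k] {X : Scheme.{u}} (f : X ⟶ Spec (.of k))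
    (hX : IsRegularProjectiveCurve f)
    {ι M N : Type*} [Fintype ι] [AddCommGroup M] [Module ℂ M] [AddCommGroup N] [Module ℂ N]
    (P : RootPairing ι ℂ M N) [P.IsRootSystem] [P.IsCrystallographic] [P.IsReduced]
    (b : P.Base) (p : b.support)
    (l : List b.support) (hl : l.Nodup) (hlp : ∀ j, j ∈ l ↔ j ≠ p) :
    -- the residue of the period reduces to a sum over `𝔚_p`
    ((∀ w ∉ b.specialWeyl p,
        b.parabolicResidue p l (b.periodTerm (Nat.card k) (completeZeta f) w)
          =ᶠ[Filter.codiscrete ℂ] fun _ => 0) ∧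
      (∀ w ∈ b.specialWeyl p,
        b.parabolicResidue p l (b.periodTerm (Nat.card k) (completeZeta f) w)
          =ᶠ[Filter.codiscrete ℂ] b.residueTerm (Nat.card k) (completeZeta f) p w) ∧
      b.parabolicPeriod (Nat.card k) (completeZeta f) p l
        =ᶠ[Filter.codiscrete ℂ]
          fun s => ∑ᶠ w ∈ b.specialWeyl p, b.residueTerm (Nat.card k) (completeZeta f) p w s) ∧
    -- there is exactly one minimal family of normalizing zeta factors, given by root counting
    (∃! m, b.IsMinimalNormalization p m) ∧
    (∀ a c : ℕ, 2 ≤ c →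
      ((b.minimalFactors p).count ((a : ℂ), (c : ℂ)) : ℤ) = b.countM p a c) ∧
    (∀ x ∈ b.minimalFactors p, ∃ a c : ℕ, 2 ≤ c ∧ x = ((a : ℂ), (c : ℂ))) ∧
    -- the formula for the zeta function of `(G,P)`
    (∀ s : ℂ, b.groupZeta (Nat.card k) (completeZeta f) p l s =
      b.parabolicPeriod (Nat.card k) (completeZeta f) p l s *
        ∏ᶠ (a : ℕ) (c : ℕ) (_ : 2 ≤ c), completeZeta f (a * s + c) ^ b.countM p a c) := by
  exact theorem6_general Finite.one_lt_card hX.isZetaLike_completeZeta P b p l hl hlp
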